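/- Let $K\ge 1$, $T>0$ and $B\in\mathbb R$. Let $\mathcal N$ be the network obtained from $K$ copies $\overline{I_1},\dots,\overline{I_K}$ of $(-\infty,0]$ by gluing them at $0$, with its path metric, and let $H_i:[0,T]\times(-\infty,0]\times\mathbb R\to\mathbb R$ $(1\le i\le K)$ be Lipschitz continuous on $[0,T]\times(-\infty,0]\times[-R,R]$ for every $R>0$ and coercive: $H_i(t,x,p)\to\infty$ as $|p|\to\infty$, uniformly in $(t,x)$. Consider the time-dependent Kirchhoff problem $$u_t+H_i(t,x,u_{x_i})=0\ \text{ in } I_i\times(0,T],\qquad \sum_{i=1}^K u_{x_i}=B\ \text{ on }\{0\}\times(0,T].$$ Test functions are the continuous $\varphi:\mathcal N\times[0,T]\to\mathbb R$ whose restriction to each $\overline{I_i}\times[0,T]$ is $C^1$ up to the boundary. An upper semi-continuous $u:\mathcal N\times[0,T]\to\mathbb R$ is a sub-solution if, for every test function $\varphi$ and every local maximum $(x,t)$ of $u-\varphi$ in $\mathcal N\times[0,T]$ with $t>0$, $$\varphi_t(x,t)+H_i(t,x,\varphi_{x_i}(x,t))\le 0\quad\text{if } x\in I_i=(-\infty,0),$$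 $$\min\Big\{\sum_{i=1}^K\varphi_{x_i}(0,t)-B,\ \varphi_t(0,t)+\min_i H_i(t,0,\varphi_{x_i}(0,t))\Big\}\le 0\quad\text{if } x=0.$$ A lower semi-continuous $v:\mathcal N\times[0,T]\to\mathbb R$ is a super-solution if the same holds with local minima of $v-\varphi$, with $\ge$ in place of $\le$, and with both minima replaced by maxima. Let $u$ be a bounded sub-solution and $v$ a bounded super-solution. Assume that at least one of $u(\cdot,0)$, $v(\cdot,0)$ is uniformly continuous on $\mathcal N$, and that the $H_i$ do not depend on $t$ or at least one of $u$, $v$ is Lipschitz continuous on $\mathcal N\times[0,T]$. Then, for every $t\in[0,T]$, $$\sup_{x\in\mathcal N}\big(u(x,t)-v(x,t)\big)\le\sup_{x\in\mathcal N}\big(u(x,0)-v(x,0)\big).$$ -/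

import Mathlib

/-!
The network is `K` copies of the half-line `(-∞, 0]` glued at `0`.  A point is a pair `(i, x)` with
`x ≤ 0`, where all the pairs `(i, 0)` are the same point, the junction.  A real function on
(network) × `[0, T]` is a family `w i x t` whose members agree at `x = 0`; only its values at
`x ≤ 0`, `t ∈ [0, T]` are ever used.
-/

/-- The closed edge `(-∞, 0]` times `[0, T]`. -/
def edgeCyl (T : ℝ) : Set (ℝ × ℝ) := Set.Iic 0 ×ˢ Set.Icc 0 T

/-- The members of the family agree at the junction: it is a function on (network) × `[0, T]`. -/
def Glued {K : ℕ} (T : ℝ) (w : Fin K → ℝ → ℝ → ℝ) : Prop :=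
  ∀ i j : Fin K, ∀ t ∈ Set.Icc 0 T, w i 0 t = w j 0 t

/-- A test function on (network) × `[0, T]`: continuous on the network, and on each closed edge
continuously differentiable in `(x, t)` up to the boundary (one-sided derivatives at `x = 0`,
`t = 0`, `t = T`).  The slopes `dx i 0 t` at the junction may differ from edge to edge. -/
structure NetworkTestFunction (K : ℕ) (T : ℝ) where
  /-- the function itself -/
  val : Fin K → ℝ → ℝ → ℝ
  /-- its space derivative on each edge -/
  dx : Fin K → ℝ → ℝ → ℝ
  /-- its time derivative -/
  dt : Fin K → ℝ → ℝ → ℝ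
  glued : Glued T val
  continuousOn_val : ∀ i, ContinuousOn (fun z : ℝ × ℝ => val i z.1 z.2) (edgeCyl T)
  continuousOn_dx : ∀ i, ContinuousOn (fun z : ℝ × ℝ => dx i z.1 z.2) (edgeCyl T)
  continuousOn_dt : ∀ i, ContinuousOn (fun z : ℝ × ℝ => dt i z.1 z.2) (edgeCyl T)
  hasDeriv_dx : ∀ i, ∀ x ≤ (0 : ℝ), ∀ t ∈ Set.Icc 0 T,
    HasDerivWithinAt (fun y => val i y t) (dx i x t) (Set.Iic 0) x
  hasDeriv_dt : ∀ i, ∀ x ≤ (0 : ℝ), ∀ t ∈ Set.Icc 0 T,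
    HasDerivWithinAt (fun s => val i x s) (dt i x t) (Set.Icc 0 T) t

/-- `u` is a viscosity sub-solution of `u_t + H_i(t, x, u_{x_i}) = 0` on the edges with the
Kirchhoff condition `∑ u_{x_i} = B` at the junction.  At the junction
`min {∑ φ_{x_i} - B, φ_t + min_i H_i(t, 0, φ_{x_i})} ≤ 0` is written out as a disjunction
(`φ.dt i 0 t` does not depend on `i`, because `φ` is glued). -/
structure IsSubsolution {K : ℕ} (T B : ℝ) (H : Fin K → ℝ → ℝ → ℝ → ℝ)
    (u : Fin K → ℝ → ℝ → ℝ) : Prop where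
  glued : Glued T u
  usc : ∀ i, UpperSemicontinuousOn (fun z : ℝ × ℝ => u i z.1 z.2) (edgeCyl T)
  edge : ∀ (φ : NetworkTestFunction K T) (i : Fin K), ∀ x < (0 : ℝ), ∀ t ∈ Set.Ioc 0 T,
    IsLocalMaxOn (fun z : ℝ × ℝ => u i z.1 z.2 - φ.val i z.1 z.2) (edgeCyl T) (x, t) →
      φ.dt i x t + H i t x (φ.dx i x t) ≤ 0
  junction : ∀ (φ : NetworkTestFunction K T), ∀ t ∈ Set.Ioc 0 T,
    (∀ i, IsLocalMaxOn (fun z : ℝ × ℝ => u i z.1 z.2 - φ.val i z.1 z.2) (edgeCyl T) (0, t)) →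
      (∑ i, φ.dx i 0 t ≤ B) ∨ ∃ i, φ.dt i 0 t + H i t 0 (φ.dx i 0 t) ≤ 0

/-- `v` is a viscosity super-solution of the same problem.  At the junction
`max {∑ φ_{x_i} - B, φ_t + max_i H_i(t, 0, φ_{x_i})} ≥ 0` is written out as a disjunction. -/
structure IsSupersolution {K : ℕ} (T B : ℝ) (H : Fin K → ℝ → ℝ → ℝ → ℝ)
    (v : Fin K → ℝ → ℝ → ℝ) : Prop where
  glued : Glued T v
  lsc : ∀ i, LowerSemicontinuousOn (fun z : ℝ × ℝ => v i z.1 z.2) (edgeCyl T)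
  edge : ∀ (φ : NetworkTestFunction K T) (i : Fin K), ∀ x < (0 : ℝ), ∀ t ∈ Set.Ioc 0 T,
    IsLocalMinOn (fun z : ℝ × ℝ => v i z.1 z.2 - φ.val i z.1 z.2) (edgeCyl T) (x, t) →
      0 ≤ φ.dt i x t + H i t x (φ.dx i x t)
  junction : ∀ (φ : NetworkTestFunction K T), ∀ t ∈ Set.Ioc 0 T,
    (∀ i, IsLocalMinOn (fun z : ℝ × ℝ => v i z.1 z.2 - φ.val i z.1 z.2) (edgeCyl T) (0, t)) →
      (B ≤ ∑ i, φ.dx i 0 t) ∨ ∃ i, 0 ≤ φ.dt i 0 t + H i t 0 (φ.dx i 0 t)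

/-- Each `H_i` is Lipschitz on `[0, T] × (-∞, 0] × [-R, R]`, for every `R`. -/
def HamiltonianLipschitz {K : ℕ} (T : ℝ) (H : Fin K → ℝ → ℝ → ℝ → ℝ) : Prop :=
  ∀ i, ∀ R > (0 : ℝ), ∃ L : ℝ, ∀ t ∈ Set.Icc 0 T, ∀ s ∈ Set.Icc 0 T, ∀ x ≤ (0 : ℝ), ∀ y ≤ (0 : ℝ),
    ∀ p q : ℝ, |p| ≤ R → |q| ≤ R →
      |H i t x p - H i s y q| ≤ L * (|t - s| + |x - y| + |p - q|)

/-- `H_i(t, x, p) → ∞` as `|p| → ∞`, uniformly in `(t, x)`. -/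
def HamiltonianCoercive {K : ℕ} (T : ℝ) (H : Fin K → ℝ → ℝ → ℝ → ℝ) : Prop :=
  ∀ i, ∀ M : ℝ, ∃ R : ℝ, ∀ t ∈ Set.Icc 0 T, ∀ x ≤ (0 : ℝ), ∀ p : ℝ, R ≤ |p| → M ≤ H i t x p

/-- The Hamiltonians do not depend on time. -/
def TimeIndependent {K : ℕ} (T : ℝ) (H : Fin K → ℝ → ℝ → ℝ → ℝ) : Prop :=
  ∀ i, ∀ t ∈ Set.Icc 0 T, ∀ s ∈ Set.Icc 0 T, ∀ x ≤ (0 : ℝ), ∀ p : ℝ, H i t x p = H i s x p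

/-- `w` is bounded on (network) × `[0, T]`. -/
def BoundedOnNetwork {K : ℕ} (T : ℝ) (w : Fin K → ℝ → ℝ → ℝ) : Prop :=
  ∃ M : ℝ, ∀ i, ∀ x ≤ (0 : ℝ), ∀ t ∈ Set.Icc 0 T, |w i x t| ≤ M

/-- `w` is Lipschitz on (network) × `[0, T]`.  For a glued family an estimate along each edge is
the same as one for the path metric of the network. -/
def LipschitzOnNetwork {K : ℕ} (T : ℝ) (w : Fin K → ℝ → ℝ → ℝ) : Prop :=
  ∃ L : ℝ, ∀ i, ∀ x ≤ (0 : ℝ), ∀ y ≤ (0 : ℝ), ∀ t ∈ Set.Icc 0 T, ∀ s ∈ Set.Icc 0 T,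
    |w i x t - w i y s| ≤ L * (|x - y| + |t - s|)

/-- `w(·, 0)` is uniformly continuous on the network; again it suffices to look at each edge. -/
def InitiallyUniformlyContinuous {K : ℕ} (w : Fin K → ℝ → ℝ → ℝ) : Prop :=
  ∀ i, UniformContinuousOn (fun x => w i x 0) (Set.Iic 0)

/-- `sup (u(·, t) - v(·, t))`, the supremum over the network. -/
noncomputable def supDiff {K : ℕ} (u v : Fin K → ℝ → ℝ → ℝ) (t : ℝ) : ℝ :=
  ⨆ z : Fin K × Set.Iic (0 : ℝ), (u z.1 z.2 t - v z.1 z.2 t)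

/-! Suppose `u - v` exceeds its initial bound somewhere. Only time is doubled: `u(x, t) - v(x, s) -
(t - s)² / 2ε` is maximised over a single space variable, after subtracting from `u` a small `η t`,
which makes the inequality strict, and a small function of linear growth, which makes the maximum
exist. A barrier (`SepSubsolution.initial_layer`) keeps both times `τ`, `σ` of the maximum positive.

At the maximum the coupling `(t - s)²` is replaced by a sum `ψ t + χ s`, with a quadratic gain to
spare (`SepSubsolution.not_doubled_max`). Then `U = u - ψ` and `W = -v - χ` are sub-solutions of
equations `f ≤ 0`, `g ≤ 0` in which time is a mere parameter, `U(x, t) + W(x, s)` is maximal at the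
point, and `f(p) ≤ 0` forces `g(-p) > 0` there. Inside an edge, doubling `x` contradicts this
(`interior_contradiction`).

At the junction one looks at the difference quotients of `max_t U` on each edge separately. For
every slope between their lower and upper limits the equation holds up to the end point
(`EdgeSubsolution.nonpos_of_slope`). Playing this for `U` against `W` yields on each edge an open
interval of slopes `p` such that `p` touches `U`, `-p` touches `W`, and both equations fail
(`exists_slope_interval`). Only the Kirchhoff alternative is left: it gives `∑ p_i ≤ B` for all such
slopes from `u` and `∑ p_i ≥ B` from `v`, impossible on open intervals (`junction_contradiction`).
-/

/-! ### Separated test functions and attained maxima -/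

section Kirchhoff

open Set Filter Topology

/-- The test function `θ i x + ψ t` with separated variables. -/
noncomputable def NetworkTestFunction.separable {K : ℕ} (T : ℝ) (θ : Fin K → ℝ → ℝ) (ψ : ℝ → ℝ)
    (hθ : ∀ i, ContDiff ℝ 1 (θ i)) (hψ : ContDiff ℝ 1 ψ) (h0 : ∀ i j, θ i 0 = θ j 0) :
    NetworkTestFunction K T where
  val i x t := θ i x + ψ t
  dx i x _ := deriv (θ i) x
  dt _ _ t := deriv ψ t
  glued i j t _ := by simp only [h0 i j]
  continuousOn_val i := by
    have h1 := (hθ i).continuous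
    have h2 := hψ.continuous
    fun_prop
  continuousOn_dx i :=
    (((hθ i).continuous_deriv le_rfl).comp continuous_fst).continuousOn
  continuousOn_dt i := ((hψ.continuous_deriv le_rfl).comp continuous_snd).continuousOn
  hasDeriv_dx i x _ t _ :=
    ((((hθ i).differentiable one_ne_zero) x).hasDerivAt.add_const (ψ t)).hasDerivWithinAt
  hasDeriv_dt i x _ t _ :=
    (((hψ.differentiable one_ne_zero) t).hasDerivAt.const_add (θ i x)).hasDerivWithinAt

/-- Sub-solutions of `u_t + F_i(t, x, u_{x_i}) = 0`, `∑ u_{x_i} = B`, tested only with functions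
`θ i x + ψ t`. -/
structure SepSubsolution {K : ℕ} (T B : ℝ) (F : Fin K → ℝ → ℝ → ℝ → ℝ)
    (u : Fin K → ℝ → ℝ → ℝ) : Prop where
  glued : Glued T u
  usc : ∀ i, UpperSemicontinuousOn (fun z : ℝ × ℝ => u i z.1 z.2) (edgeCyl T)
  edge : ∀ θ ψ : ℝ → ℝ, ContDiff ℝ 1 θ → ContDiff ℝ 1 ψ → ∀ i, ∀ x < (0 : ℝ), ∀ t ∈ Ioc 0 T,
    IsLocalMaxOn (fun z : ℝ × ℝ => u i z.1 z.2 - (θ z.1 + ψ z.2)) (edgeCyl T) (x, t) →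
      deriv ψ t + F i t x (deriv θ x) ≤ 0
  junction : ∀ (θ : Fin K → ℝ → ℝ) (ψ : ℝ → ℝ), (∀ i, ContDiff ℝ 1 (θ i)) → ContDiff ℝ 1 ψ →
    (∀ i j, θ i 0 = θ j 0) → ∀ t ∈ Ioc 0 T,
    (∀ i, IsLocalMaxOn (fun z : ℝ × ℝ => u i z.1 z.2 - (θ i z.1 + ψ z.2)) (edgeCyl T) (0, t)) →
      (∑ i, deriv (θ i) 0 ≤ B) ∨ ∃ i, deriv ψ t + F i t 0 (deriv (θ i) 0) ≤ 0

variable {K : ℕ} {T B : ℝ} {F H : Fin K → ℝ → ℝ → ℝ → ℝ} {u v w : Fin K → ℝ → ℝ → ℝ}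

theorem IsSubsolution.sepSubsolution (hu : IsSubsolution T B H u) : SepSubsolution T B H u where
  glued := hu.glued
  usc := hu.usc
  edge θ ψ hθ hψ i x hx t ht hm :=
    hu.edge (.separable T (fun _ => θ) ψ (fun _ => hθ) hψ fun _ _ => rfl) i x hx t ht hm
  junction θ ψ hθ hψ h0 t ht hm := hu.junction (.separable T θ ψ hθ hψ h0) t ht hm

/-- Reflection turns super-solutions into sub-solutions, so every later estimate is proved once. The
new Hamiltonian `-H(-p)` is not coercive; coercivity is therefore only ever asked of the equation
for `u`. -/
theorem IsSupersolution.neg_sepSubsolution (hv : IsSupersolution T B H v) :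
    SepSubsolution T (-B) (fun i t x p => -H i t x (-p)) (fun i x t => -v i x t) where
  glued i j t ht := by simp only [hv.glued i j t ht]
  usc i x hx y hy := by
    filter_upwards [hv.lsc i x hx (-y) (by dsimp only at hy ⊢; linarith)] with z hz
    linarith
  edge θ ψ hθ hψ i x hx t ht hm := by
    have := hv.edge (.separable T (fun _ x => -θ x) (fun t => -ψ t) (fun _ => hθ.neg) hψ.neg
      fun _ _ => rfl) i x hx t ht (by
        filter_upwards [hm] with z hz
        simp only [NetworkTestFunction.separable] at hz ⊢
        linarith)
    simp only [NetworkTestFunction.separable, deriv.fun_neg'] at this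
    linarith
  junction θ ψ hθ hψ h0 t ht hm := by
    have := hv.junction (.separable T (fun i x => -θ i x) (fun t => -ψ t) (fun i => (hθ i).neg)
      hψ.neg fun i j => by simp only [h0 i j]) t ht (fun i => by
        filter_upwards [hm i] with z hz
        simp only [NetworkTestFunction.separable] at hz ⊢
        linarith)
    simp only [NetworkTestFunction.separable, deriv.fun_neg', Finset.sum_neg_distrib] at this
    refine this.imp (fun h => by linarith) fun ⟨i, h⟩ => ⟨i, by linarith⟩

/-- Subtracting `h x + η t` from a sub-solution shifts the Hamiltonian. -/
theorem SepSubsolution.sub_separable (hu : SepSubsolution T B F u) {h : ℝ → ℝ}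
    (hh : ContDiff ℝ 1 h) (hh0 : deriv h 0 = 0) (η : ℝ) :
    SepSubsolution T B (fun i t x p => F i t x (p + deriv h x) + η)
      (fun i x t => u i x t - (h x + η * t)) where
  glued i j t ht := by simp only [hu.glued i j t ht]
  usc i := by
    have hc : ContinuousOn (fun z : ℝ × ℝ => -(h z.1 + η * z.2)) (edgeCyl T) := by
      have := hh.continuous
      fun_prop
    simpa only [sub_eq_add_neg] using (hu.usc i).add hc.upperSemicontinuousOn
  edge θ ψ hθ hψ i x hx t ht hm := by
    have hη : ContDiff ℝ 1 fun t : ℝ => η * t := by fun_prop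
    have := hu.edge (fun x => θ x + h x) (fun t => ψ t + η * t) (hθ.add hh) (hψ.add hη) i x hx t ht
      (by filter_upwards [hm] with z hz
          linarith)
    rw [deriv_fun_add (hθ.differentiable one_ne_zero x) (hh.differentiable one_ne_zero x),
      deriv_fun_add (hψ.differentiable one_ne_zero t) (hη.differentiable one_ne_zero t)] at this
    simp at this
    linarith
  junction θ ψ hθ hψ h0 t ht hm := by
    have hη : ContDiff ℝ 1 fun t : ℝ => η * t := by fun_prop
    have := hu.junction (fun i x => θ i x + h x) (fun t => ψ t + η * t) (fun i => (hθ i).add hh)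
      (hψ.add hη) (fun i j => by simp only [h0 i j]) t ht
      (fun i => by
        filter_upwards [hm i] with z hz
        linarith)
    -- As `h' 0 = 0`, the shift leaves the Kirchhoff sum unchanged.
    have e : ∀ i, deriv (fun x => θ i x + h x) 0 = deriv (θ i) 0 := fun i => by
      rw [deriv_fun_add ((hθ i).differentiable one_ne_zero 0) (hh.differentiable one_ne_zero 0), hh0,
        add_zero]
    rw [deriv_fun_add (hψ.differentiable one_ne_zero t) (hη.differentiable one_ne_zero t)] at this
    simp only [e] at this
    refine this.imp id fun ⟨i, hi⟩ => ⟨i, ?_⟩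
    simp only [hh0, add_zero]
    simp at hi
    linarith

/-- A finite family of upper semi-continuous functions attains its overall maximum, if outside of
compact sets all of them stay below some value. -/
theorem exists_family_max {ι X : Type*} [Finite ι] [TopologicalSpace X] {S : Set X} {C : Set X}
    (hC : IsCompact C) (hCS : C ⊆ S) {f : ι → X → ℝ} (hf : ∀ i, UpperSemicontinuousOn (f i) S)
    {i₀ : ι} {x₀ : X} (hx₀ : x₀ ∈ S) (hout : ∀ i, ∀ x ∈ S, x ∉ C → f i x < f i₀ x₀) :
    ∃ i, ∃ x ∈ C, ∀ j, ∀ y ∈ S, f j y ≤ f i x := by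
  have hx₀C : x₀ ∈ C := by
    by_contra h
    exact lt_irrefl _ (hout i₀ x₀ hx₀ h)
  have hmax : ∀ i, ∃ x ∈ C, IsMaxOn (f i) C x := fun i =>
    ((hf i).mono hCS).exists_isMaxOn ⟨x₀, hx₀C⟩ hC
  choose x hxC hx using hmax
  have : Nonempty ι := ⟨i₀⟩
  obtain ⟨i, hi⟩ := Finite.exists_max fun i => f i (x i)
  refine ⟨i, x i, hxC i, fun j y hy => ?_⟩
  by_cases hyC : y ∈ C
  · exact (hx j hyC).trans (hi j)
  · exact (hout j y hy hyC).le.trans ((hx i₀ hx₀C).trans (hi i₀))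

end Kirchhoff

/-! ### One-sided slopes at the end of an edge -/

section Edge

open Set Filter Topology

/-- Sub-solutions of `f(t, x, U_x) ≤ 0` on an edge, tested with functions of `x` only. -/
structure EdgeSubsolution (T : ℝ) (f : ℝ → ℝ → ℝ → ℝ) (U : ℝ → ℝ → ℝ) : Prop where
  usc : UpperSemicontinuousOn (fun z : ℝ × ℝ => U z.1 z.2) (edgeCyl T)
  edge : ∀ θ : ℝ → ℝ, ContDiff ℝ 1 θ → ∀ x < (0 : ℝ), ∀ t ∈ Ioc 0 T,
    IsLocalMaxOn (fun z : ℝ × ℝ => U z.1 z.2 - θ z.1) (edgeCyl T) (x, t) →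
      f t x (deriv θ x) ≤ 0

/-- The Hamiltonian is continuous on its domain. -/
def ContinuousHamiltonian (T : ℝ) (f : ℝ → ℝ → ℝ → ℝ) : Prop :=
  ContinuousOn (fun z : ℝ × ℝ × ℝ => f z.1 z.2.1 z.2.2) (Icc 0 T ×ˢ Iic 0 ×ˢ univ)

/-- The slopes `p` such that `U x t ≤ U 0 τ + p x` near the end of the edge. -/
def upperSlopes (T τ : ℝ) (U : ℝ → ℝ → ℝ) : Set ℝ :=
  {p | ∃ δ > 0, ∀ x ∈ Icc (-δ) 0, ∀ t ∈ Icc 0 T, U x t ≤ U 0 τ + p * x}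

/-- The slopes `p` such that `max_t U x t ≥ U 0 τ + p x` near the end of the edge. -/
def lowerSlopes (T τ : ℝ) (U : ℝ → ℝ → ℝ) : Set ℝ :=
  {p | ∃ δ > 0, ∀ x ∈ Icc (-δ) 0, ∃ t ∈ Icc 0 T, U 0 τ + p * x ≤ U x t}

variable {T τ c : ℝ} {f : ℝ → ℝ → ℝ → ℝ} {U : ℝ → ℝ → ℝ}

theorem upperSlopes_of_le {p q : ℝ} (hq : q ∈ upperSlopes T τ U) (hpq : p ≤ q) :
    p ∈ upperSlopes T τ U := by
  obtain ⟨δ, hδ, h⟩ := hq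
  refine ⟨δ, hδ, fun x hx t ht => (h x hx t ht).trans ?_⟩
  nlinarith [hx.2]

theorem lowerSlopes_of_le {p q : ℝ} (hq : q ∈ lowerSlopes T τ U) (hpq : q ≤ p) :
    p ∈ lowerSlopes T τ U := by
  obtain ⟨δ, hδ, h⟩ := hq
  refine ⟨δ, hδ, fun x hx => ?_⟩
  obtain ⟨t, ht, h⟩ := h x hx
  refine ⟨t, ht, le_trans ?_ h⟩
  nlinarith [hx.2]

theorem le_of_upperSlopes_of_lowerSlopes {p q : ℝ} (hp : p ∈ upperSlopes T τ U)
    (hq : q ∈ lowerSlopes T τ U) : p ≤ q := by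
  obtain ⟨δ, hδ, h⟩ := hp
  obtain ⟨δ', hδ', h'⟩ := hq
  have hm : 0 < min δ δ' := lt_min hδ hδ'
  obtain ⟨t, ht, h1⟩ := h' (-min δ δ') ⟨neg_le_neg (min_le_right _ _), by linarith⟩
  have h2 := h (-min δ δ') ⟨neg_le_neg (min_le_left _ _), by linarith⟩ t ht
  by_contra! hlt
  nlinarith

/-- A value that beats both lateral sides pushes the maximum over the rectangle into `a < x < b`.
Time is not localised, so `t = 0` must be excluded by the user. -/
theorem EdgeSubsolution.exists_touch (hU : EdgeSubsolution T f U) {θ : ℝ → ℝ}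
    (hθ : ContDiff ℝ 1 θ) {a b x₁ t₁ : ℝ} (hb0 : b ≤ 0) (hx₁ : x₁ ∈ Icc a b) (ht₁ : t₁ ∈ Icc 0 T)
    (ha : ∀ t ∈ Icc 0 T, U a t - θ a < U x₁ t₁ - θ x₁)
    (hb : ∀ t ∈ Icc 0 T, U b t - θ b < U x₁ t₁ - θ x₁) :
    ∃ x ∈ Ioo a b, ∃ t ∈ Icc 0 T, U x₁ t₁ - θ x₁ ≤ U x t - θ x ∧
      (0 < t → f t x (deriv θ x) ≤ 0) := by
  have hsub : Icc a b ×ˢ Icc 0 T ⊆ edgeCyl T :=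
    prod_mono (fun y hy => hy.2.trans hb0) subset_rfl
  have husc : UpperSemicontinuousOn (fun z : ℝ × ℝ => U z.1 z.2 - θ z.1) (Icc a b ×ˢ Icc 0 T) := by
    have hc : ContinuousOn (fun z : ℝ × ℝ => -θ z.1) (Icc a b ×ˢ Icc 0 T) := by
      have := hθ.continuous
      fun_prop
    simpa only [sub_eq_add_neg] using (hU.usc.mono hsub).add hc.upperSemicontinuousOn
  obtain ⟨⟨x, t⟩, ⟨hx, ht⟩, hm⟩ :=
    husc.exists_isMaxOn ⟨(x₁, t₁), mk_mem_prod hx₁ ht₁⟩ (isCompact_Icc.prod isCompact_Icc)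
  have h1 : U x₁ t₁ - θ x₁ ≤ U x t - θ x := isMaxOn_iff.1 hm (x₁, t₁) ⟨hx₁, ht₁⟩
  have hxa : a ≠ x := by
    rintro rfl
    exact absurd h1 (ha t ht).not_ge
  have hxb : x ≠ b := by
    rintro rfl
    exact absurd h1 (hb t ht).not_ge
  have hx' : x ∈ Ioo a b := ⟨lt_of_le_of_ne hx.1 hxa, lt_of_le_of_ne hx.2 hxb⟩
  refine ⟨x, hx', t, ht, h1, fun ht0 => hU.edge θ hθ x (hx'.2.trans_le hb0) t ⟨ht0, ht.2⟩ ?_⟩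
  have hn : ∀ᶠ z : ℝ × ℝ in 𝓝[edgeCyl T] (x, t), z.1 ∈ Ioo a b :=
    mem_nhdsWithin_of_mem_nhds (continuousAt_fst.preimage_mem_nhds (Ioo_mem_nhds hx'.1 hx'.2))
  filter_upwards [hn, self_mem_nhdsWithin] with z hz hz'
  exact hm ⟨Ioo_subset_Icc_self hz, hz'.2⟩

/-- If `U 0 ·` stays below `m` on a compact set of times, so does `U x ·` for `x` near `0`. -/
theorem exists_forall_lt_near (husc : UpperSemicontinuousOn (fun z : ℝ × ℝ => U z.1 z.2) (edgeCyl T))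
    {C : Set ℝ} (hC : IsCompact C) (hCT : C ⊆ Icc 0 T) {m : ℝ} (hm : ∀ t ∈ C, U 0 t < m) :
    ∃ δ > 0, ∀ x ∈ Icc (-δ) 0, ∀ t ∈ C, U x t < m := by
  have h : ∀ᶠ x in 𝓝 (0 : ℝ), ∀ t ∈ C, (x, t) ∈ edgeCyl T → U x t < m := by
    refine hC.eventually_forall_of_forall_eventually fun t ht => ?_
    exact eventually_nhdsWithin_iff.1 (husc (0, t) ⟨le_refl (0 : ℝ), hCT ht⟩ m (hm t ht))
  obtain ⟨δ, hδ, h⟩ := Metric.eventually_nhds_iff.1 h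
  refine ⟨δ / 2, half_pos hδ, fun x hx t ht => h ?_ t ht ⟨hx.2, hCT ht⟩⟩
  rw [Real.dist_eq, sub_zero, abs_of_nonpos hx.2]
  linarith [hx.1]

/-- Near the end of the edge there is no strict interior touching with a strict
super-solution. -/
theorem EdgeSubsolution.not_touch (hU : EdgeSubsolution T f U) (hc : 0 < c)
    (hmax : ∀ t ∈ Icc 0 T, U 0 t ≤ U 0 τ - c * (t - τ) ^ 2) {ρ : ℝ} (hρ : 0 < ρ) (hρτ : ρ ≤ τ) :
    ∃ δ > 0, ∀ (θ : ℝ → ℝ) (a x₁ t₁ : ℝ), ContDiff ℝ 1 θ → -δ ≤ a → x₁ ∈ Icc a 0 → t₁ ∈ Icc 0 T →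
      (∀ t ∈ Icc 0 T, U a t - θ a < U x₁ t₁ - θ x₁) → U 0 τ - θ 0 < U x₁ t₁ - θ x₁ →
      (∀ x ∈ Icc a 0, U 0 τ - δ ≤ U x₁ t₁ - θ x₁ + θ x) →
      ¬ ∀ x ∈ Ioo a 0, ∀ t ∈ Icc 0 T, |t - τ| < ρ → 0 < f t x (deriv θ x) := by
  -- At times farther than `ρ` from `τ`, `U` stays below `U 0 τ - c ρ² / 2` near the junction. A
  -- touching point whose value is almost `U 0 τ` thus has `|t - τ| < ρ ≤ τ`, hence `t > 0`.
  have hC : IsCompact (Icc 0 T ∩ {t | ρ ≤ |t - τ|}) :=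
    isCompact_Icc.inter_right (isClosed_le continuous_const (by fun_prop))
  obtain ⟨δ, hδ, h⟩ := exists_forall_lt_near hU.usc hC inter_subset_left
    (m := U 0 τ - c * ρ ^ 2 / 2) (fun t ht => by
      have h1 := hmax t ht.1
      have h2 : ρ ^ 2 ≤ (t - τ) ^ 2 := by
        rw [← sq_abs (t - τ)]
        exact pow_le_pow_left₀ hρ.le ht.2 2
      nlinarith [mul_le_mul_of_nonneg_left h2 hc.le, mul_pos hc (pow_pos hρ 2)])
  refine ⟨min δ (c * ρ ^ 2 / 2), lt_min hδ (by positivity), ?_⟩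
  intro θ a x₁ t₁ hθ ha hx₁ ht₁ hat h0 hval hpos
  obtain ⟨x, hx, t, ht, h1, h2⟩ := hU.exists_touch hθ le_rfl hx₁ ht₁ hat fun t ht => by
    have := hmax t ht
    nlinarith [mul_nonneg hc.le (sq_nonneg (t - τ))]
  have hx' : x ∈ Icc a 0 := Ioo_subset_Icc_self hx
  have htτ : |t - τ| < ρ := by
    by_contra! hge
    have h3 := h x ⟨by linarith [min_le_left δ (c * ρ ^ 2 / 2), hx'.1], hx'.2⟩ t ⟨ht, hge⟩
    have h4 := hval x hx'
    linarith [min_le_right δ (c * ρ ^ 2 / 2)]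
  have := h2 (by linarith [(abs_lt.1 htτ).1])
  exact absurd this (hpos x hx t ht htτ).not_ge

theorem ContinuousHamiltonian.exists_pos (hf : ContinuousHamiltonian T f) {x₀ p : ℝ}
    (hτ : τ ∈ Ioc 0 T) (hx₀ : x₀ ≤ 0) (hp : 0 < f τ x₀ p) :
    ∃ ρ > 0, ρ ≤ τ ∧ ∀ t ∈ Icc 0 T, ∀ x ≤ (0 : ℝ), ∀ q, |t - τ| < ρ → |x - x₀| < ρ → |q - p| < ρ →
      0 < f t x q := by
  have h := hf (τ, x₀, p) ⟨Ioc_subset_Icc_self hτ, hx₀, mem_univ _⟩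
  have h2 := eventually_nhdsWithin_iff.1 (h.eventually (lt_mem_nhds hp))
  obtain ⟨ρ, hρ, h3⟩ := Metric.eventually_nhds_iff.1 h2
  refine ⟨min ρ τ, lt_min hρ hτ.1, min_le_right _ _, fun t ht x hx q h1 h2 h4 => ?_⟩
  refine h3 (y := (t, x, q)) ?_ ⟨ht, hx, mem_univ _⟩
  simp only [Prod.dist_eq, Real.dist_eq]
  exact max_lt (h1.trans_le (min_le_left _ _)) (max_lt (h2.trans_le (min_le_left _ _))
    (h4.trans_le (min_le_left _ _)))

/-- The equation holds up to the end of the edge for all intermediate slopes. -/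
theorem EdgeSubsolution.nonpos_of_slope (hU : EdgeSubsolution T f U)
    (hf : ContinuousHamiltonian T f) (hτ : τ ∈ Ioc 0 T) (hc : 0 < c)
    (hmax : ∀ t ∈ Icc 0 T, U 0 t ≤ U 0 τ - c * (t - τ) ^ 2) {p : ℝ}
    (hp : ∀ ε > 0, p + ε ∉ upperSlopes T τ U) (hp' : ∀ ε > 0, p - ε ∉ lowerSlopes T τ U) :
    f τ 0 p ≤ 0 := by
  by_contra! hpos
  obtain ⟨ρ, hρ, hρτ, hf⟩ := hf.exists_pos hτ le_rfl hpos
  obtain ⟨δ, hδ, hno⟩ := hU.not_touch hc hmax hρ hρτ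
  -- If the quotients oscillate across some `q` near `p`, then `U - q x` is low at some `a` and high
  -- at a later point, so it has an interior maximum. Otherwise `p` is nearly a derivative, and a
  -- convex bump creates the maximum.
  by_cases hq : ∃ q, |q - p| < ρ ∧ q ∉ upperSlopes T τ U ∧ q ∉ lowerSlopes T τ U
  · obtain ⟨q, hqp, hqu, hql⟩ := hq
    simp only [upperSlopes, lowerSlopes, mem_ofPred_eq, not_exists, not_and, not_forall,
      not_le] at hqu hql
    have hq0 : 0 < |q| + 1 := by positivity
    -- The last bound keeps `|q x| ≤ δ` on `[a, 0]`, as `hno` requires.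
    have hδ' : 0 < min (min δ (ρ / 2)) (δ / (|q| + 1)) :=
      lt_min (lt_min hδ (half_pos hρ)) (div_pos hδ hq0)
    obtain ⟨a, ha, haU⟩ := hql _ hδ'
    have ha0 : a < 0 := by
      refine lt_of_le_of_ne ha.2 ?_
      rintro rfl
      have := haU τ (Ioc_subset_Icc_self hτ)
      simp at this
    obtain ⟨x₁, hx₁, t₁, ht₁, h1⟩ := hqu (-a) (by linarith)
    rw [neg_neg] at hx₁
    have hda : -(min δ (ρ / 2)) ≤ a := (neg_le_neg (min_le_left _ _)).trans ha.1
    have hda' : -(δ / (|q| + 1)) ≤ a := (neg_le_neg (min_le_right _ _)).trans ha.1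
    have hdd : δ / (|q| + 1) * (|q| + 1) = δ := div_mul_cancel₀ _ hq0.ne'
    refine hno (fun x => q * x) a x₁ t₁ (by fun_prop)
      ((neg_le_neg (min_le_left _ _)).trans hda) hx₁ ht₁ (fun t ht => ?_) ?_ (fun x hx => ?_) ?_
    · have := haU t ht
      linarith
    · linarith
    · have : -δ ≤ q * x := by
        have e1 : |q * x| ≤ δ := by
          rw [abs_mul, abs_of_nonpos hx.2]
          nlinarith [abs_nonneg q, hx.1, hx.2]
        linarith [(abs_le.1 e1).1]
      linarith
    · intro x hx t ht htτ
      have e : deriv (fun x => q * x) x = q := by simp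
      rw [e]
      refine hf t ht x hx.2.le q htτ ?_ hqp
      rw [sub_zero, abs_of_neg hx.2]
      linarith [hx.1, min_le_right δ (ρ / 2)]
  · push Not at hq
    have hlow : p - ρ / 16 ∈ upperSlopes T τ U := by
      by_contra h
      refine hp' (ρ / 16) (by positivity) (hq _ ?_ h)
      rw [abs_lt]
      constructor <;> linarith
    have hupp : p + ρ / 16 ∈ lowerSlopes T τ U := by
      refine hq _ ?_ (hp _ (by positivity))
      rw [abs_lt]
      constructor <;> linarith
    obtain ⟨δ₁, hδ₁, h1⟩ := hlow
    obtain ⟨δ₂, hδ₂, h2⟩ := hupp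
    have hq0 : 0 < 2 * |p| + ρ := by positivity
    set r := min (min (δ / 2) (ρ / 4)) (min (min (δ₁ / 2) δ₂) (δ / (2 * |p| + ρ))) with hr
    have hr0 : 0 < r := by
      refine lt_min (lt_min (half_pos hδ) ?_) (lt_min (lt_min (half_pos hδ₁) hδ₂) (div_pos hδ hq0))
      positivity
    have r1 : r ≤ δ / 2 := (min_le_left _ _).trans (min_le_left _ _)
    have r2 : r ≤ ρ / 4 := (min_le_left _ _).trans (min_le_right _ _)
    have r3 : r ≤ δ₁ / 2 := (min_le_right _ _).trans ((min_le_left _ _).trans (min_le_left _ _))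
    have r4 : r ≤ δ₂ := (min_le_right _ _).trans ((min_le_left _ _).trans (min_le_right _ _))
    have r5 : r ≤ δ / (2 * |p| + ρ) := (min_le_right _ _).trans (min_le_right _ _)
    clear_value r
    rw [le_div_iff₀ hq0] at r5
    obtain ⟨t₁, ht₁, h3⟩ := h2 (-r) ⟨by linarith, by linarith⟩
    have hpr := abs_le.1 (le_refl |p|)
    -- The bump vanishes at `-r` and equals `ρ r / 4` at `-2r` and `0`. This outweighs the slope
    -- errors, `ρ r / 16` at `-r` and `ρ r / 8` at `-2r`, while the derivative stays within `ρ / 2`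
    -- of `p`.
    refine hno (fun x => p * x + ρ / 4 / r * (x + r) ^ 2) (-2 * r) (-r) t₁ (by fun_prop)
      (by linarith) ⟨by linarith, by linarith⟩ ht₁ (fun t ht => ?_) ?_ (fun x hx => ?_) ?_
    · have h4 := h1 (-2 * r) ⟨by linarith, by linarith⟩ t ht
      have e1 : ρ / 4 / r * (-2 * r + r) ^ 2 = ρ / 4 * r := by field_simp; ring
      have e2 : ρ / 4 / r * (-r + r) ^ 2 = 0 := by ring
      simp only [e1, e2]
      nlinarith
    · have e1 : ρ / 4 / r * (0 + r) ^ 2 = ρ / 4 * r := by field_simp; ring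
      have e2 : ρ / 4 / r * (-r + r) ^ 2 = 0 := by ring
      simp only [e1, e2]
      nlinarith
    · have e2 : ρ / 4 / r * (-r + r) ^ 2 = 0 := by ring
      have e3 : 0 ≤ ρ / 4 / r * (x + r) ^ 2 := by positivity
      have e4 : -(2 * r * |p|) ≤ p * x := by
        have e1 : |p * x| ≤ 2 * r * |p| := by
          rw [abs_mul, abs_of_nonpos hx.2]
          nlinarith [abs_nonneg p, hx.1, hx.2]
        linarith [(abs_le.1 e1).1]
      simp only [e2]
      nlinarith
    · intro x hx t ht htτ
      have e : deriv (fun x => p * x + ρ / 4 / r * (x + r) ^ 2) x = p + ρ / 2 * ((x + r) / r) := by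
        have : HasDerivAt (fun x => p * x + ρ / 4 / r * (x + r) ^ 2)
            (p * 1 + ρ / 4 / r * (2 * (x + r) ^ 1 * 1)) x := by
          have := (((hasDerivAt_id x).add_const r).pow 2).const_mul (ρ / 4 / r)
          exact ((hasDerivAt_id x).const_mul p).add (by simpa using this)
        rw [this.deriv]
        field_simp
        ring
      rw [e]
      refine hf t ht x hx.2.le _ htτ ?_ ?_
      · rw [sub_zero, abs_of_neg hx.2]
        linarith [hx.1]
      · have : |(x + r) / r| ≤ 1 := by
          rw [abs_div, abs_of_pos hr0, div_le_one hr0, abs_le]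
          constructor <;> linarith [hx.1, hx.2]
        rw [add_sub_cancel_left, abs_mul, abs_of_pos (half_pos hρ)]
        nlinarith

/-- Coercivity keeps the slope at the end of the edge from being `-∞`. -/
theorem EdgeSubsolution.upperSlopes_nonempty (hU : EdgeSubsolution T f U) (hτ : τ ∈ Ioc 0 T)
    (hc : 0 < c) (hmax : ∀ t ∈ Icc 0 T, U 0 t ≤ U 0 τ - c * (t - τ) ^ 2) {R : ℝ}
    (hf : ∀ t ∈ Icc 0 T, ∀ x ≤ (0 : ℝ), ∀ p, R ≤ |p| → 0 < f t x p) :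
    (upperSlopes T τ U).Nonempty := by
  obtain ⟨δ, hδ, hno⟩ := hU.not_touch hc hmax hτ.1 le_rfl
  obtain ⟨δ₁, hδ₁, h1⟩ := exists_forall_lt_near hU.usc isCompact_Icc subset_rfl
    (m := U 0 τ + δ / 2) (fun t ht => by
      have := hmax t ht
      nlinarith [mul_nonneg hc.le (sq_nonneg (t - τ))])
  set r := min (min δ δ₁) (δ / (|R| + 1)) with hr
  have hr0 : 0 < r := lt_min (lt_min hδ hδ₁) (by positivity)
  have r1 : r ≤ δ := (min_le_left _ _).trans (min_le_left _ _)
  have r2 : r ≤ δ₁ := (min_le_left _ _).trans (min_le_right _ _)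
  have r3 : r ≤ δ / (|R| + 1) := min_le_right _ _
  clear_value r
  rw [le_div_iff₀ (by positivity)] at r3
  have hP : R ≤ δ / r := by
    rw [le_div_iff₀ hr0]
    nlinarith [le_abs_self R]
  have hPr : δ / r * r = δ := div_mul_cancel₀ _ hr0.ne'
  -- The line of slope `-δ / r` has risen by `δ` at `-r`, above `U` there. If `U` crossed it in
  -- between, it would be touched with a slope of modulus at least `R`, against coercivity.
  refine ⟨-(δ / r), r, hr0, ?_⟩
  by_contra! hcon
  obtain ⟨x₁, hx₁, t₁, ht₁, h2⟩ := hcon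
  refine hno (fun x => -(δ / r) * x) (-r) x₁ t₁ (by fun_prop) (by linarith) hx₁ ht₁
    (fun t ht => ?_) ?_ (fun x hx => ?_) ?_
  · have := h1 (-r) ⟨by linarith, by linarith⟩ t ht
    linarith
  · linarith
  · have : 0 < δ / r := by positivity
    nlinarith [hx.2]
  · intro x hx t ht _
    have e : deriv (fun x => -(δ / r) * x) x = -(δ / r) := by simp
    rw [e]
    refine hf t ht x hx.2.le _ ?_
    rwa [abs_neg, abs_of_pos (by positivity)]

end Edge

/-! ### No common maximum, at the junction or inside an edge -/

section Contradictions

open Set Filter Topology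

variable {T τ σ c : ℝ}

/-- Because `U + W` is maximal at the end point, a line below `max_t U` gives the opposite line
above `W`. -/
theorem mem_upperSlopes_of_mem_lowerSlopes {U W : ℝ → ℝ → ℝ}
    (hUW : ∀ x ≤ (0 : ℝ), ∀ t ∈ Icc 0 T, ∀ s ∈ Icc 0 T, U x t + W x s ≤ U 0 τ + W 0 σ) {p : ℝ}
    (hp : p ∈ lowerSlopes T τ U) : -p ∈ upperSlopes T σ W := by
  obtain ⟨δ, hδ, h⟩ := hp
  refine ⟨δ, hδ, fun x hx s hs => ?_⟩
  obtain ⟨t, ht, h1⟩ := h x hx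
  linarith [hUW x hx.2 t ht s hs]

/-- At a common maximum at the end of an edge there is an interval of slopes that touch `U` from
above, whose opposites touch `W` from above, and for which both equations fail. -/
theorem exists_slope_interval {f g : ℝ → ℝ → ℝ → ℝ} {U W : ℝ → ℝ → ℝ}
    (hU : EdgeSubsolution T f U) (hW : EdgeSubsolution T g W)
    (hf : ContinuousHamiltonian T f) (hg : ContinuousHamiltonian T g)
    (hτ : τ ∈ Ioc 0 T) (hσ : σ ∈ Ioc 0 T) (hc : 0 < c)
    (hUmax : ∀ t ∈ Icc 0 T, U 0 t ≤ U 0 τ - c * (t - τ) ^ 2)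
    (hWmax : ∀ t ∈ Icc 0 T, W 0 t ≤ W 0 σ - c * (t - σ) ^ 2)
    (hUW : ∀ x ≤ (0 : ℝ), ∀ t ∈ Icc 0 T, ∀ s ∈ Icc 0 T, U x t + W x s ≤ U 0 τ + W 0 σ)
    {R : ℝ} (hcoer : ∀ t ∈ Icc 0 T, ∀ x ≤ (0 : ℝ), ∀ p, R ≤ |p| → 0 < f t x p)
    (hbdd : BddAbove (upperSlopes T τ U)) (hne : (upperSlopes T τ U).Nonempty)
    (hcontra : ∀ p, f τ 0 p ≤ 0 → 0 < g σ 0 (-p)) :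
    ∃ l r, l < r ∧ ∀ p ∈ Ioo l r, p ∈ upperSlopes T τ U ∧ -p ∈ upperSlopes T σ W ∧
      0 < f τ 0 p ∧ 0 < g σ 0 (-p) := by
  have hWU : ∀ x ≤ (0 : ℝ), ∀ t ∈ Icc 0 T, ∀ s ∈ Icc 0 T, W x t + U x s ≤ W 0 σ + U 0 τ :=
    fun x hx t ht s hs => by linarith [hUW x hx s hs t ht]
  have hτ' := Ioc_subset_Icc_self hτ
  have hσ' := Ioc_subset_Icc_self hσ
  have hfc : Continuous fun p => f τ 0 p :=
    hf.comp_continuous (f := fun p : ℝ => (τ, (0 : ℝ), p)) (by fun_prop)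
      fun p => ⟨hτ', le_refl (0 : ℝ), mem_univ _⟩
  have hgc : Continuous fun p => g σ 0 p :=
    hg.comp_continuous (f := fun p : ℝ => (σ, (0 : ℝ), p)) (by fun_prop)
      fun p => ⟨hσ', le_refl (0 : ℝ), mem_univ _⟩
  set a := sSup (upperSlopes T τ U) with ha
  have hlt : ∀ p < a, p ∈ upperSlopes T τ U := fun p hp => by
    obtain ⟨q, hq, hpq⟩ := exists_lt_of_lt_csSup hne hp
    exact upperSlopes_of_le hq hpq.le
  have hgt : ∀ p, a < p → p ∉ upperSlopes T τ U := fun p hp h => (le_csSup hbdd h).not_gt hp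
  have hfa : f τ 0 a ≤ 0 := by
    refine hU.nonpos_of_slope hf hτ hc hUmax (fun ε hε => hgt _ (by linarith)) fun ε hε h => ?_
    have := le_of_upperSlopes_of_lowerSlopes (hlt (a - ε / 2) (by linarith)) h
    linarith
  -- Otherwise `p` would be intermediate for `U` and `-p` for `W`, and both equations would hold.
  have hi : ∀ p, a < p → -p ∈ upperSlopes T σ W := by
    intro p hp
    by_contra hno
    have h1 : f τ 0 p ≤ 0 := by
      refine hU.nonpos_of_slope hf hτ hc hUmax (fun ε hε => hgt _ (by linarith)) fun ε hε h => ?_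
      exact hno (mem_upperSlopes_of_mem_lowerSlopes hUW (lowerSlopes_of_le h (by linarith)))
    have h2 : g σ 0 (-p) ≤ 0 := by
      refine hW.nonpos_of_slope hg hσ hc hWmax (fun ε hε h => ?_) fun ε hε h => ?_
      · exact hno (upperSlopes_of_le h (by linarith))
      · exact hgt _ (by linarith) (mem_upperSlopes_of_mem_lowerSlopes hWU h)
    exact (hcontra p h1).not_ge h2
  -- `p₀` is `-sup` of the slopes of `W`, where `g ≤ 0` forces `f > 0`. If that supremum is
  -- infinite, coercivity provides a very negative `p₀`.
  obtain ⟨p₀, hp₀a, hfp₀, hp₀W⟩ : ∃ p₀ < a, 0 < f τ 0 p₀ ∧ ∀ p > p₀, -p ∈ upperSlopes T σ W := by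
    by_cases hbW : BddAbove (upperSlopes T σ W)
    · set b := sSup (upperSlopes T σ W) with hb
      have hneW : (upperSlopes T σ W).Nonempty := ⟨_, hi (a + 1) (by linarith)⟩
      have hltW : ∀ p < b, p ∈ upperSlopes T σ W := fun p hp => by
        obtain ⟨q, hq, hpq⟩ := exists_lt_of_lt_csSup hneW hp
        exact upperSlopes_of_le hq hpq.le
      have hgtW : ∀ p, b < p → p ∉ upperSlopes T σ W := fun p hp h =>
        (le_csSup hbW h).not_gt hp
      have hgb : g σ 0 b ≤ 0 := by
        refine hW.nonpos_of_slope hg hσ hc hWmax (fun ε hε => hgtW _ (by linarith))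
          fun ε hε h => ?_
        have := le_of_upperSlopes_of_lowerSlopes (hltW (b - ε / 2) (by linarith)) h
        linarith
      have hfb : 0 < f τ 0 (-b) := by
        by_contra! h
        have := hcontra _ h
        rw [neg_neg] at this
        exact this.not_ge hgb
      refine ⟨-b, ?_, hfb, fun p hp => hltW _ (by linarith)⟩
      rcases lt_trichotomy (-b) a with h | h | h
      · exact h
      · rw [h] at hfb
        exact absurd hfa hfb.not_ge
      · exact absurd (hi ((a - b) / 2) (by linarith)) (hgtW _ (by linarith))
    · refine ⟨min (a - 1) (-|R|), (min_le_left _ _).trans_lt (by linarith), ?_, fun p _ => ?_⟩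
      · refine hcoer τ hτ' 0 le_rfl _ ?_
        have h1 := min_le_right (a - 1) (-|R|)
        have h2 := neg_abs_le (min (a - 1) (-|R|))
        linarith [le_abs_self R]
      · obtain ⟨q, hq, hpq⟩ := not_bddAbove_iff.1 hbW (-p)
        exact upperSlopes_of_le hq hpq.le
  have hZ : IsCompact (Icc p₀ a ∩ {p | f τ 0 p ≤ 0}) :=
    isCompact_Icc.inter_right (isClosed_le hfc continuous_const)
  -- Just to the left of the first `q` with `f q ≤ 0`, `f` is still positive, and `g(-p)` is
  -- positive by continuity.
  obtain ⟨q, ⟨⟨hq₀, hqa⟩, hfq⟩, hqmin⟩ := hZ.exists_isLeast ⟨a, ⟨hp₀a.le, le_rfl⟩, hfa⟩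
  have hq₀' : p₀ < q := lt_of_le_of_ne hq₀ fun h => by
    rw [h] at hfp₀
    exact hfp₀.not_ge hfq
  have hgq : ∀ᶠ p in 𝓝 q, 0 < g σ 0 (-p) :=
    (hgc.comp continuous_neg).continuousAt.eventually (lt_mem_nhds (hcontra q hfq))
  obtain ⟨ρ, hρ, hgρ⟩ := Metric.eventually_nhds_iff.1 hgq
  refine ⟨max p₀ (q - ρ), q, max_lt hq₀' (by linarith), fun p hp => ?_⟩
  have h1 : p₀ < p := (le_max_left _ _).trans_lt hp.1
  have h2 : q - ρ < p := (le_max_right _ _).trans_lt hp.1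
  refine ⟨hlt p (hp.2.trans_le hqa), hp₀W p h1, ?_, hgρ ?_⟩
  · by_contra! h
    exact (hqmin ⟨⟨h1.le, hp.2.le.trans hqa⟩, h⟩).not_gt hp.2
  · rw [Real.dist_eq, abs_lt]
    constructor <;> linarith [hp.2]

/-- No common maximum at the junction. -/
theorem junction_contradiction {K : ℕ} (hK : 0 < K) {B : ℝ} {f g : Fin K → ℝ → ℝ → ℝ → ℝ}
    {U W : Fin K → ℝ → ℝ → ℝ}
    (hU : ∀ i, EdgeSubsolution T (f i) (U i)) (hW : ∀ i, EdgeSubsolution T (g i) (W i))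
    (hf : ∀ i, ContinuousHamiltonian T (f i)) (hg : ∀ i, ContinuousHamiltonian T (g i))
    (hτ : τ ∈ Ioc 0 T) (hσ : σ ∈ Ioc 0 T) (hc : 0 < c)
    (hUmax : ∀ i, ∀ t ∈ Icc 0 T, U i 0 t ≤ U i 0 τ - c * (t - τ) ^ 2)
    (hWmax : ∀ i, ∀ t ∈ Icc 0 T, W i 0 t ≤ W i 0 σ - c * (t - σ) ^ 2)
    (hUW : ∀ i, ∀ x ≤ (0 : ℝ), ∀ t ∈ Icc 0 T, ∀ s ∈ Icc 0 T,
      U i x t + W i x s ≤ U i 0 τ + W i 0 σ)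
    {R : ℝ} (hcoer : ∀ i, ∀ t ∈ Icc 0 T, ∀ x ≤ (0 : ℝ), ∀ p, R ≤ |p| → 0 < f i t x p)
    (hJU : ∀ p : Fin K → ℝ, (∀ i, p i ∈ upperSlopes T τ (U i)) →
      ∑ i, p i ≤ B ∨ ∃ i, f i τ 0 (p i) ≤ 0)
    (hJW : ∀ p : Fin K → ℝ, (∀ i, p i ∈ upperSlopes T σ (W i)) →
      ∑ i, p i ≤ -B ∨ ∃ i, g i σ 0 (p i) ≤ 0)
    (hcontra : ∀ i p, f i τ 0 p ≤ 0 → 0 < g i σ 0 (-p)) : False := by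
  have hne : ∀ i, (upperSlopes T τ (U i)).Nonempty := fun i =>
    (hU i).upperSlopes_nonempty hτ hc (hUmax i) (hcoer i)
  have hbdd : ∀ i, BddAbove (upperSlopes T τ (U i)) := by
    intro i
    by_contra hb
    choose q hq using hne
    have hall : ∀ p, p ∈ upperSlopes T τ (U i) := fun p => by
      obtain ⟨r, hr, hpr⟩ := not_bddAbove_iff.1 hb p
      exact upperSlopes_of_le hr hpr.le
    -- An unbounded edge could carry a slope so large that the sum exceeds `B`. All slopes have
    -- modulus at least `|R|`, so the equations fail too.
    let p₀ : Fin K → ℝ := fun j => min (q j) (-|R|)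
    let P : ℝ := max |R| (B + 1 - ∑ j ∈ Finset.univ \ {i}, p₀ j)
    have hmem : ∀ j, Function.update p₀ i P j ∈ upperSlopes T τ (U j) := fun j => by
      by_cases hij : j = i
      · subst hij
        exact hall _
      · rw [Function.update_of_ne hij]
        exact upperSlopes_of_le (hq j) (min_le_left _ _)
    rcases hJU (Function.update p₀ i P) hmem with h | ⟨j, h⟩
    · rw [Finset.sum_update_of_mem (Finset.mem_univ i)] at h
      linarith [le_max_right |R| (B + 1 - ∑ j ∈ Finset.univ \ {i}, p₀ j)]
    · refine absurd h (hcoer j τ (Ioc_subset_Icc_self hτ) 0 le_rfl _ ?_).not_ge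
      by_cases hij : j = i
      · subst hij
        rw [Function.update_self]
        exact (le_abs_self R).trans ((le_max_left _ _).trans (le_abs_self _))
      · rw [Function.update_of_ne hij]
        have h1 : p₀ j ≤ -|R| := min_le_right _ _
        linarith [neg_abs_le (p₀ j), le_abs_self R]
  have hint := fun i => exists_slope_interval (hU i) (hW i) (hf i) (hg i) hτ hσ hc (hUmax i)
    (hWmax i) (hUW i) (hcoer i) (hbdd i) (hne i) (hcontra i)
  choose l r hlr hint using hint
  have hm : ∀ i, (l i + r i) / 2 ∈ Ioo (l i) (r i) := fun i => by
    constructor <;> linarith [hlr i]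
  have hm' : ∀ i, (l i + 3 * r i) / 4 ∈ Ioo (l i) (r i) := fun i => by
    constructor <;> linarith [hlr i]
  -- The midpoints test `W`; slopes farther right in the same intervals test `U` and make the sum
  -- strictly exceed `B`.
  have hge : B ≤ ∑ i, (l i + r i) / 2 := by
    rcases hJW (fun i => -((l i + r i) / 2)) (fun i => (hint i _ (hm i)).2.1) with h | ⟨i, h⟩
    · rw [Finset.sum_neg_distrib] at h
      linarith
    · exact absurd h ((hint i _ (hm i)).2.2.2).not_ge
  have hlt : ∑ i, (l i + r i) / 2 < ∑ i, (l i + 3 * r i) / 4 :=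
    Finset.sum_lt_sum_of_nonempty ⟨⟨0, hK⟩, Finset.mem_univ _⟩ fun i _ => by linarith [hlr i]
  rcases hJU (fun i => (l i + 3 * r i) / 4) (fun i => (hint i _ (hm' i)).1) with h | ⟨i, h⟩
  · linarith
  · exact absurd h ((hint i _ (hm' i)).2.2.1).not_ge

/-- No common maximum inside an edge. -/
theorem interior_contradiction {f g : ℝ → ℝ → ℝ → ℝ} {U W : ℝ → ℝ → ℝ} {x₀ : ℝ}
    (hU : EdgeSubsolution T f U) (hW : EdgeSubsolution T g W)
    (hf : ContinuousHamiltonian T f) (hg : ContinuousHamiltonian T g)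
    (hτ : τ ∈ Ioc 0 T) (hσ : σ ∈ Ioc 0 T) (hc : 0 < c) (hx₀ : x₀ < 0)
    (hUW : ∀ x ≤ (0 : ℝ), ∀ t ∈ Icc 0 T, ∀ s ∈ Icc 0 T,
      U x t + W x s ≤ U x₀ τ + W x₀ σ - c * ((t - τ) ^ 2 + (s - σ) ^ 2))
    {R : ℝ} (hcoer : ∀ t ∈ Icc 0 T, ∀ x ≤ (0 : ℝ), ∀ p, R ≤ |p| → 0 < f t x p)
    (hcontra : ∀ p, f τ x₀ p ≤ 0 → 0 < g σ x₀ (-p)) : False := by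
  have hτ' := Ioc_subset_Icc_self hτ
  have hσ' := Ioc_subset_Icc_self hσ
  set Q : Set (ℝ × ℝ) := Icc (x₀ - 1) 0 ×ˢ Icc 0 T with hQdef
  have hQ : IsCompact Q := isCompact_Icc.prod isCompact_Icc
  have hQT : Q ⊆ edgeCyl T := prod_mono (fun y hy => hy.2) subset_rfl
  have hmem : ∀ t ∈ Icc 0 T, (x₀, t) ∈ Q := fun t ht => ⟨⟨by linarith, hx₀.le⟩, ht⟩
  obtain ⟨M₁, hM₁⟩ := (hU.usc.mono hQT).bddAbove_of_isCompact hQ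
  obtain ⟨M₂, hM₂⟩ := (hW.usc.mono hQT).bddAbove_of_isCompact hQ
  have hM₁ : ∀ z ∈ Q, U z.1 z.2 ≤ M₁ := fun z hz => hM₁ (mem_image_of_mem _ hz)
  have hM₂ : ∀ z ∈ Q, W z.1 z.2 ≤ M₂ := fun z hz => hM₂ (mem_image_of_mem _ hz)
  -- Space is doubled here, while each function keeps its own time. The term `(x - x₀)²` and the
  -- quadratic gain in `hUW` bring the maxima back to `(x₀, τ)` and `(x₀, σ)`.
  have hex : ∀ n : ℕ, ∃ z ∈ Q ×ˢ Q, IsMaxOn (fun z : (ℝ × ℝ) × (ℝ × ℝ) =>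
      U z.1.1 z.1.2 + W z.2.1 z.2.2 + -(n * (z.1.1 - z.2.1) ^ 2 + (z.1.1 - x₀) ^ 2))
      (Q ×ˢ Q) z := by
    intro n
    refine UpperSemicontinuousOn.exists_isMaxOn ⟨((x₀, τ), (x₀, σ)), hmem τ hτ', hmem σ hσ'⟩
      (hQ.prod hQ) ?_
    have h1 : UpperSemicontinuousOn (fun z : (ℝ × ℝ) × (ℝ × ℝ) => U z.1.1 z.1.2) (Q ×ˢ Q) :=
      (hU.usc.mono hQT).comp (g := Prod.fst) continuous_fst.continuousOn fun z hz => hz.1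
    have h2 : UpperSemicontinuousOn (fun z : (ℝ × ℝ) × (ℝ × ℝ) => W z.2.1 z.2.2) (Q ×ˢ Q) :=
      (hW.usc.mono hQT).comp (g := Prod.snd) continuous_snd.continuousOn fun z hz => hz.2
    have h3 : ContinuousOn (fun z : (ℝ × ℝ) × (ℝ × ℝ) =>
      -(n * (z.1.1 - z.2.1) ^ 2 + (z.1.1 - x₀) ^ 2)) (Q ×ˢ Q) := by fun_prop
    exact (h1.add h2).add h3.upperSemicontinuousOn
  choose Z hZ hZmax using hex
  have hZmax : ∀ n, ∀ z ∈ Q, ∀ z' ∈ Q,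
      U z.1 z.2 + W z'.1 z'.2 - (n * (z.1 - z'.1) ^ 2 + (z.1 - x₀) ^ 2) ≤
      U (Z n).1.1 (Z n).1.2 + W (Z n).2.1 (Z n).2.2 -
        (n * ((Z n).1.1 - (Z n).2.1) ^ 2 + ((Z n).1.1 - x₀) ^ 2) := fun n z hz z' hz' => by
    simpa only [sub_eq_add_neg] using isMaxOn_iff.1 (hZmax n) (z, z') ⟨hz, hz'⟩
  have hval : ∀ n, U x₀ τ + W x₀ σ ≤ U (Z n).1.1 (Z n).1.2 + W (Z n).2.1 (Z n).2.2 -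
        (n * ((Z n).1.1 - (Z n).2.1) ^ 2 + ((Z n).1.1 - x₀) ^ 2) := fun n => by
    simpa using hZmax n _ (hmem τ hτ') _ (hmem σ hσ')
  -- Limits along an ultrafilter replace successive extractions of subsequences.
  set 𝒰 := hyperfilter ℕ with h𝒰
  have h𝒰top : (𝒰 : Filter ℕ) ≤ atTop := Nat.hyperfilter_le_atTop
  obtain ⟨⟨⟨x, t⟩, ⟨y, s⟩⟩, ⟨hz₁, hz₂⟩, hlim⟩ := (hQ.prod hQ).ultrafilter_le_nhds' (𝒰.map Z)
    (show ∀ᶠ n in (𝒰 : Filter ℕ), Z n ∈ Q ×ˢ Q from Eventually.of_forall hZ)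
  replace hlim : Tendsto Z 𝒰 (𝓝 ((x, t), (y, s))) := hlim
  have hl1 : Tendsto (fun n => (Z n).1) 𝒰 (𝓝 (x, t)) := (continuous_fst.tendsto _).comp hlim
  have hl2 : Tendsto (fun n => (Z n).2) 𝒰 (𝓝 (y, s)) := (continuous_snd.tendsto _).comp hlim
  have hx : Tendsto (fun n => (Z n).1.1) 𝒰 (𝓝 x) := (continuous_fst.tendsto _).comp hl1
  have ht : Tendsto (fun n => (Z n).1.2) 𝒰 (𝓝 t) := (continuous_snd.tendsto _).comp hl1
  have hy : Tendsto (fun n => (Z n).2.1) 𝒰 (𝓝 y) := (continuous_fst.tendsto _).comp hl2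
  have hs : Tendsto (fun n => (Z n).2.2) 𝒰 (𝓝 s) := (continuous_snd.tendsto _).comp hl2
  have hxy : x = y := by
    have h1 : Tendsto (fun n : ℕ => (M₁ + M₂ - (U x₀ τ + W x₀ σ)) / n) 𝒰 (𝓝 0) :=
      (tendsto_const_div_atTop_nhds_zero_nat _).mono_left h𝒰top
    have h2 : Tendsto (fun n => ((Z n).1.1 - (Z n).2.1) ^ 2) 𝒰 (𝓝 ((x - y) ^ 2)) :=
      (hx.sub hy).pow 2
    have h3 : (x - y) ^ 2 ≤ 0 := by
      refine le_of_tendsto_of_tendsto h2 h1 ?_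
      filter_upwards [h𝒰top (eventually_gt_atTop 0)] with n hn
      rw [le_div_iff₀ (Nat.cast_pos.2 hn)]
      have := hval n
      have := hM₁ _ (hZ n).1
      have := hM₂ _ (hZ n).2
      nlinarith [sq_nonneg ((Z n).1.1 - x₀)]
    nlinarith [pow_eq_zero_iff (two_ne_zero) |>.1 (le_antisymm h3 (sq_nonneg _))]
  subst hxy
  have hle : U x₀ τ + W x₀ σ ≤ U x t + W x s - (x - x₀) ^ 2 := by
    refine le_of_forall_pos_le_add fun ε hε => ?_
    have h1 : ∀ᶠ n in (𝒰 : Filter ℕ), U (Z n).1.1 (Z n).1.2 < U x t + ε / 3 :=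
      (tendsto_nhdsWithin_iff.2 ⟨hl1, Eventually.of_forall fun n => hQT (hZ n).1⟩).eventually
        (hU.usc (x, t) (hQT hz₁) _ (by dsimp only; linarith))
    have h2 : ∀ᶠ n in (𝒰 : Filter ℕ), W (Z n).2.1 (Z n).2.2 < W x s + ε / 3 :=
      (tendsto_nhdsWithin_iff.2 ⟨hl2, Eventually.of_forall fun n => hQT (hZ n).2⟩).eventually
        (hW.usc (x, s) (hQT hz₂) _ (by dsimp only; linarith))
    have h3 : ∀ᶠ n in (𝒰 : Filter ℕ), (x - x₀) ^ 2 - ε / 3 < ((Z n).1.1 - x₀) ^ 2 :=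
      ((hx.sub_const x₀).pow 2).eventually (lt_mem_nhds (by linarith))
    obtain ⟨n, h1, h2, h3⟩ := (h1.and (h2.and h3)).exists
    have h4 : (0 : ℝ) ≤ n * ((Z n).1.1 - (Z n).2.1) ^ 2 := by positivity
    linarith [hval n]
  have hsum := hUW x hz₁.1.2 t hz₁.2 s hz₂.2
  have hz : ∀ a : ℝ, a ^ 2 ≤ 0 → a = 0 := fun a ha => by
    exact pow_eq_zero_iff (two_ne_zero) |>.1 (le_antisymm ha (sq_nonneg _))
  have hxx : x = x₀ := sub_eq_zero.1 (hz _ (by nlinarith [sq_nonneg (t - τ), sq_nonneg (s - σ)]))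
  have hcs : c * ((t - τ) ^ 2 + (s - σ) ^ 2) ≤ 0 := by nlinarith [sq_nonneg (x - x₀)]
  have hcs' : (t - τ) ^ 2 + (s - σ) ^ 2 ≤ 0 := by
    by_contra! h
    exact hcs.not_gt (mul_pos hc h)
  have htt : t = τ := sub_eq_zero.1 (hz _ (by nlinarith [sq_nonneg (s - σ)]))
  have hss : s = σ := sub_eq_zero.1 (hz _ (by nlinarith [sq_nonneg (t - τ)]))
  subst hxx htt hss
  have hloc : ∀ {a b : ℝ}, a ∈ Ioo (x - 1) 0 → ∀ᶠ z in 𝓝[edgeCyl T] (a, b), z ∈ Q := by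
    intro a b ha
    have hn : ∀ᶠ z : ℝ × ℝ in 𝓝[edgeCyl T] (a, b), z.1 ∈ Ioo (x - 1) 0 :=
      mem_nhdsWithin_of_mem_nhds (continuousAt_fst.preimage_mem_nhds (Ioo_mem_nhds ha.1 ha.2))
    filter_upwards [hn, self_mem_nhdsWithin] with z hz hz'
    exact ⟨Ioo_subset_Icc_self hz, hz'.2⟩
  have hfe : ∀ᶠ n in (𝒰 : Filter ℕ), f (Z n).1.2 (Z n).1.1
      (2 * n * ((Z n).1.1 - (Z n).2.1) + 2 * ((Z n).1.1 - x)) ≤ 0 := by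
    filter_upwards [hx.eventually (Ioo_mem_nhds (by linarith : x - 1 < x) hx₀),
      ht.eventually (lt_mem_nhds hτ.1)] with n hn hn'
    have hd : HasDerivAt (fun a => n * (a - (Z n).2.1) ^ 2 + (a - x) ^ 2)
        (2 * n * ((Z n).1.1 - (Z n).2.1) + 2 * ((Z n).1.1 - x)) (Z n).1.1 := by
      have h1 := (((hasDerivAt_id (Z n).1.1).sub_const (Z n).2.1).pow 2).const_mul (n : ℝ)
      have h2 := ((hasDerivAt_id (Z n).1.1).sub_const x).pow 2
      exact (h1.add h2).congr_deriv (by simp; ring)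
    have := hU.edge (fun a => n * (a - (Z n).2.1) ^ 2 + (a - x) ^ 2) (by fun_prop) (Z n).1.1 hn.2
      (Z n).1.2 ⟨hn', (hZ n).1.2.2⟩ (by
        filter_upwards [hloc (b := (Z n).1.2) hn] with z hz
        linarith [hZmax n z hz _ (hZ n).2])
    rwa [hd.deriv] at this
  have hge : ∀ᶠ n in (𝒰 : Filter ℕ), g (Z n).2.2 (Z n).2.1
      (-(2 * n * ((Z n).1.1 - (Z n).2.1))) ≤ 0 := by
    filter_upwards [hy.eventually (Ioo_mem_nhds (by linarith : x - 1 < x) hx₀),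
      hs.eventually (lt_mem_nhds hσ.1)] with n hn hn'
    have hd : HasDerivAt (fun a => n * ((Z n).1.1 - a) ^ 2)
        (-(2 * n * ((Z n).1.1 - (Z n).2.1))) (Z n).2.1 := by
      have h1 := (((hasDerivAt_id (Z n).2.1).const_sub (Z n).1.1).pow 2).const_mul (n : ℝ)
      exact h1.congr_deriv (by simp; ring)
    have := hW.edge (fun a => n * ((Z n).1.1 - a) ^ 2) (by fun_prop) (Z n).2.1 hn.2
      (Z n).2.2 ⟨hn', (hZ n).2.2.2⟩ (by
        filter_upwards [hloc (b := (Z n).2.2) hn] with z hz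
        linarith [hZmax n _ (hZ n).1 z hz])
    rwa [hd.deriv] at this
  -- Coercivity of `f` alone bounds both slopes, since they are opposite up to `2 (x_n - x₀) → 0`.
  have hbd : ∀ᶠ n in (𝒰 : Filter ℕ),
      2 * n * ((Z n).1.1 - (Z n).2.1) + 2 * ((Z n).1.1 - x) ∈ Icc (-R) R := by
    filter_upwards [hfe] with n hn
    refine abs_le.1 ?_
    by_contra! h
    exact hn.not_gt (hcoer _ (hZ n).1.2 _ (hZ n).1.1.2 _ h.le)
  obtain ⟨q, -, hq⟩ := (isCompact_Icc (a := -R) (b := R)).ultrafilter_le_nhds'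
    (𝒰.map fun n : ℕ => 2 * n * ((Z n).1.1 - (Z n).2.1) + 2 * ((Z n).1.1 - x)) hbd
  replace hq : Tendsto (fun n : ℕ => 2 * n * ((Z n).1.1 - (Z n).2.1) + 2 * ((Z n).1.1 - x)) 𝒰
    (𝓝 q) := hq
  have hq' : Tendsto (fun n : ℕ => -(2 * n * ((Z n).1.1 - (Z n).2.1))) 𝒰 (𝓝 (-q)) := by
    have := (hq.sub ((hx.sub_const x).const_mul 2)).neg
    simpa using this
  have hf0 : f t x q ≤ 0 := by
    have h1 := (hf (t, x, q) ⟨hτ', hx₀.le, mem_univ _⟩).tendsto.comp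
      (tendsto_nhdsWithin_iff.2 ⟨ht.prodMk_nhds (hx.prodMk_nhds hq),
        Eventually.of_forall fun n => ⟨(hZ n).1.2, (hZ n).1.1.2, mem_univ _⟩⟩)
    exact le_of_tendsto h1 hfe
  have hg0 : g s x (-q) ≤ 0 := by
    have h1 := (hg (s, x, -q) ⟨hσ', hx₀.le, mem_univ _⟩).tendsto.comp
      (tendsto_nhdsWithin_iff.2 ⟨hs.prodMk_nhds (hy.prodMk_nhds hq'),
        Eventually.of_forall fun n => ⟨(hZ n).2.2, (hZ n).2.1.2, mem_univ _⟩⟩)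
    exact le_of_tendsto h1 hge
  exact (hcontra q hf0).not_ge hg0

end Contradictions

/-! ### Separating the two times at a maximum -/

section Comparison

open Set Filter Topology

variable {K : ℕ} {T B : ℝ} {F G H : Fin K → ℝ → ℝ → ℝ → ℝ} {u w : Fin K → ℝ → ℝ → ℝ}

theorem SepSubsolution.edgeSubsolution (hu : SepSubsolution T B F u) {ψ : ℝ → ℝ}
    (hψ : ContDiff ℝ 1 ψ) (i : Fin K) :
    EdgeSubsolution T (fun t x p => deriv ψ t + F i t x p) (fun x t => u i x t - ψ t) where
  usc := by
    have hc : ContinuousOn (fun z : ℝ × ℝ => -ψ z.2) (edgeCyl T) := by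
      have := hψ.continuous
      fun_prop
    simpa only [sub_eq_add_neg] using (hu.usc i).add hc.upperSemicontinuousOn
  edge θ hθ x hx t ht hm := hu.edge θ ψ hθ hψ i x hx t ht (by
    filter_upwards [hm] with z hz
    linarith)

theorem SepSubsolution.junction_slopes (hu : SepSubsolution T B F u) {ψ : ℝ → ℝ}
    (hψ : ContDiff ℝ 1 ψ) {τ : ℝ} (hτ : τ ∈ Ioc 0 T) (p : Fin K → ℝ)
    (hp : ∀ i, p i ∈ upperSlopes T τ (fun x t => u i x t - ψ t)) :
    ∑ i, p i ≤ B ∨ ∃ i, deriv ψ τ + F i τ 0 (p i) ≤ 0 := by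
  have hd : ∀ i, deriv (fun x => p i * x) 0 = p i := fun i => by simp
  have := hu.junction (fun i x => p i * x) ψ (fun i => by fun_prop) hψ (fun i j => by simp) τ hτ
    (fun i => by
      obtain ⟨δ, hδ, h⟩ := hp i
      have hn : ∀ᶠ z : ℝ × ℝ in 𝓝[edgeCyl T] (0, τ), z.1 ∈ Ioi (-δ) :=
        mem_nhdsWithin_of_mem_nhds
          (continuousAt_fst.preimage_mem_nhds (Ioi_mem_nhds (neg_lt_zero.2 hδ)))
      filter_upwards [hn, self_mem_nhdsWithin] with z hz hz'
      have := h z.1 ⟨le_of_lt hz, hz'.1⟩ z.2 hz'.2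
      simp only [mul_zero]
      linarith)
  simpa only [hd] using this

/-- The maximum of `u i x t + w i x s - (t - s)² / 2ε` is not attained at positive times, if the
Hamiltonians are strictly separated at the maximum point. -/
theorem SepSubsolution.not_doubled_max (hK : 0 < K) (hu : SepSubsolution T B F u)
    (hw : SepSubsolution T (-B) G w) (hF : ∀ i, ContinuousHamiltonian T (F i))
    (hG : ∀ i, ContinuousHamiltonian T (G i)) (hcoer : HamiltonianCoercive T F)
    {ε : ℝ} (hε : 0 < ε) {i₀ : Fin K} {x₀ τ σ : ℝ} (hx₀ : x₀ ≤ 0) (hτ : τ ∈ Ioc 0 T)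
    (hσ : σ ∈ Ioc 0 T)
    (hmax : ∀ i, ∀ x ≤ (0 : ℝ), ∀ t ∈ Icc 0 T, ∀ s ∈ Icc 0 T,
      u i x t + w i x s - (t - s) ^ 2 / (2 * ε) ≤
        u i₀ x₀ τ + w i₀ x₀ σ - (τ - σ) ^ 2 / (2 * ε))
    (hcontra : ∀ i p, (τ - σ) / ε + F i τ x₀ p ≤ 0 → 0 < -((τ - σ) / ε) + G i σ x₀ (-p)) :
    False := by
  set l := (τ - σ) / ε with hl
  -- The linear parts expand the coupling at `(τ, σ)`. Its remainder is at most `((t - τ)² + (s -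
  -- σ)²) / ε`, so the coefficient `2 / ε` leaves a gain of `1 / ε`.
  let ψ : ℝ → ℝ := fun t => l * (t - τ) + 2 / ε * (t - τ) ^ 2
  let χ : ℝ → ℝ := fun s => -l * (s - σ) + 2 / ε * (s - σ) ^ 2
  have hquad : ∀ l' a t : ℝ, HasDerivAt (fun t => l' * (t - a) + 2 / ε * (t - a) ^ 2)
      (l' + 4 / ε * (t - a)) t := fun l' a t => by
    have h1 := ((hasDerivAt_id t).sub_const a).const_mul l'
    have h2 := (((hasDerivAt_id t).sub_const a).pow 2).const_mul (2 / ε)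
    exact (h1.add h2).congr_deriv (by simp; ring)
  have hψd : ∀ t, deriv ψ t = l + 4 / ε * (t - τ) := fun t => (hquad l τ t).deriv
  have hχd : ∀ t, deriv χ t = -l + 4 / ε * (t - σ) := fun t => (hquad (-l) σ t).deriv
  have hψ : ContDiff ℝ 1 ψ := by fun_prop
  have hχ : ContDiff ℝ 1 χ := by fun_prop
  have hψτ : ψ τ = 0 := by simp [ψ]
  have hχσ : χ σ = 0 := by simp [χ]
  have hUW : ∀ i, ∀ x ≤ (0 : ℝ), ∀ t ∈ Icc 0 T, ∀ s ∈ Icc 0 T,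
      (u i x t - ψ t) + (w i x s - χ s) ≤ (u i₀ x₀ τ - ψ τ) + (w i₀ x₀ σ - χ σ) -
        1 / ε * ((t - τ) ^ 2 + (s - σ) ^ 2) := by
    intro i x hx t ht s hs
    have h := hmax i x hx t ht s hs
    have e : (t - s) ^ 2 / (2 * ε) - (τ - σ) ^ 2 / (2 * ε) - ψ t - χ s
        = -(1 / ε * ((t - τ) ^ 2 + (s - σ) ^ 2)) -
          1 / (2 * ε) * ((t - τ) + (s - σ)) ^ 2 := by
      simp only [ψ, χ, hl]
      field_simp
      ring
    have e' : 0 ≤ 1 / (2 * ε) * ((t - τ) + (s - σ)) ^ 2 := by positivity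
    rw [hψτ, hχσ]
    linarith
  have hconT : ∀ {θ : ℝ → ℝ} {f : ℝ → ℝ → ℝ → ℝ}, ContDiff ℝ 1 θ → ContinuousHamiltonian T f →
      ContinuousHamiltonian T (fun t x p => deriv θ t + f t x p) := fun hθ hf =>
    ((hθ.continuous_deriv le_rfl).comp continuous_fst).continuousOn.add hf
  have hR : ∃ R, ∀ i, ∀ t ∈ Icc 0 T, ∀ x ≤ (0 : ℝ), ∀ p, R ≤ |p| →
      0 < deriv ψ t + F i t x p := by
    have := fun i => hcoer i (|l| + 4 / ε * T + 1)
    choose R hR using this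
    obtain ⟨R', hR'⟩ := Finite.exists_le R
    refine ⟨R', fun i t ht x hx p hp => ?_⟩
    have h1 := hR i t ht x hx p ((hR' i).trans hp)
    have h2 : -T ≤ t - τ := by linarith [ht.1, hτ.2]
    have h3 : 4 / ε * (-T) ≤ 4 / ε * (t - τ) := mul_le_mul_of_nonneg_left h2 (by positivity)
    rw [hψd]
    linarith [neg_abs_le l]
  obtain ⟨R, hR⟩ := hR
  have hf0 : ∀ i p, deriv ψ τ + F i τ x₀ p ≤ 0 → 0 < deriv χ σ + G i σ x₀ (-p) := fun i p => by
    rw [hψd, hχd]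
    simpa using hcontra i p
  have hε' : 0 < 1 / ε := by positivity
  rcases hx₀.lt_or_eq with hx₀ | rfl
  · exact interior_contradiction (hu.edgeSubsolution hψ i₀) (hw.edgeSubsolution hχ i₀)
      (hconT hψ (hF i₀)) (hconT hχ (hG i₀)) hτ hσ hε' hx₀ (hUW i₀) (hR i₀) (hf0 i₀)
  · have hτ' := Ioc_subset_Icc_self hτ
    have hσ' := Ioc_subset_Icc_self hσ
    have hUW' : ∀ i, ∀ x ≤ (0 : ℝ), ∀ t ∈ Icc 0 T, ∀ s ∈ Icc 0 T,
        (u i x t - ψ t) + (w i x s - χ s) ≤ (u i 0 τ - ψ τ) + (w i 0 σ - χ σ) -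
          1 / ε * ((t - τ) ^ 2 + (s - σ) ^ 2) := fun i => by
      rw [hu.glued i i₀ τ hτ', hw.glued i i₀ σ hσ']
      exact hUW i
    refine junction_contradiction hK (fun i => hu.edgeSubsolution hψ i)
      (fun i => hw.edgeSubsolution hχ i) (fun i => hconT hψ (hF i)) (fun i => hconT hχ (hG i))
      hτ hσ hε' (fun i t ht => ?_) (fun i s hs => ?_) (fun i x hx t ht s hs => ?_) hR
      (hu.junction_slopes hψ hτ) (hw.junction_slopes hχ hσ) hf0
    · have := hUW' i 0 le_rfl t ht σ hσ'
      simp only [sub_self, ne_eq, OfNat.ofNat_ne_zero, not_false_eq_true, zero_pow, add_zero] at this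
      linarith
    · have := hUW' i 0 le_rfl τ hτ' s hs
      simp only [sub_self, ne_eq, OfNat.ofNat_ne_zero, not_false_eq_true, zero_pow, zero_add] at this
      linarith
    · have := hUW' i x hx t ht s hs
      have h2 : 0 ≤ 1 / ε * ((t - τ) ^ 2 + (s - σ) ^ 2) := by positivity
      linarith

end Comparison

/-! ### Bounds on the Hamiltonians and the initial layer -/

section Barrier

open Set Filter Topology

variable {K : ℕ} {T B : ℝ} {F H : Fin K → ℝ → ℝ → ℝ → ℝ} {u w : Fin K → ℝ → ℝ → ℝ}

theorem hamiltonian_bddBelow (hLip : HamiltonianLipschitz T H) (hCoer : HamiltonianCoercive T H)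
    (i : Fin K) (R : ℝ) :
    ∃ C, ∀ t ∈ Icc 0 T, ∀ x ≤ (0 : ℝ), ∀ p, |p| ≤ R → -C ≤ H i t x p := by
  obtain ⟨R₀, hR₀⟩ := hCoer i 0
  set R₁ := max (max R₀ R) 1 with hR₁
  have h0 : 0 < R₁ := lt_of_lt_of_le one_pos (le_max_right _ _)
  obtain ⟨L, hL⟩ := hLip i R₁ h0
  refine ⟨|L| * (2 * R₁), fun t ht x hx p hp => ?_⟩
  have hp₁ : |p| ≤ R₁ := hp.trans ((le_max_right _ _).trans (le_max_left _ _))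
  have h1 := hL t ht t ht x hx x hx p R₁ hp₁ (abs_of_pos h0).le
  have h2 := hR₀ t ht x hx R₁ (by
    rw [abs_of_pos h0]
    exact (le_max_left _ _).trans (le_max_left _ _))
  simp only [sub_self, abs_zero, zero_add] at h1
  have h3 : |p - R₁| ≤ 2 * R₁ := by
    rw [abs_le] at hp₁ ⊢
    constructor <;> linarith [hp₁.1, hp₁.2]
  have h4 : L * |p - R₁| ≤ |L| * (2 * R₁) :=
    mul_le_mul (le_abs_self L) h3 (abs_nonneg _) (abs_nonneg _)
  linarith [(abs_le.1 (h1.trans h4)).1]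

/-- Where there is a bounded sub-solution, a coercive Hamiltonian cannot be large. -/
theorem hamiltonian_bddAbove (hT : 0 < T) (hLip : HamiltonianLipschitz T H)
    (hCoer : HamiltonianCoercive T H) (hu : SepSubsolution T B H u) (hub : BoundedOnNetwork T u)
    (i : Fin K) (R : ℝ) :
    ∃ C, ∀ t ∈ Icc 0 T, ∀ x ≤ (0 : ℝ), ∀ p, |p| ≤ R → H i t x p ≤ C := by
  obtain ⟨M, hM⟩ := hub
  have hM0 : 0 ≤ M := (abs_nonneg _).trans (hM i 0 le_rfl 0 ⟨le_rfl, hT.le⟩)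
  -- If `H` were at least `A + 1` on a window of length 2, `u + A t - (3M + 1)(y - (x - 1))²` would
  -- have an interior maximum contradicting the equation: `3M + 1` beats the oscillation of `u`
  -- laterally, and `A T = 4M + 2` excludes time `0`.
  set A := (4 * M + 2) / T with hA
  have hAT : A * T = 4 * M + 2 := div_mul_cancel₀ _ hT.ne'
  obtain ⟨R₀, hR₀⟩ := hCoer i (A + 1)
  set R₁ := max (max R₀ R) 1 with hR₁
  have h0 : 0 < R₁ := lt_of_lt_of_le one_pos (le_max_right _ _)
  obtain ⟨L, hL⟩ := hLip i R₁ h0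
  have hL' : ∀ t ∈ Icc 0 T, ∀ s ∈ Icc 0 T, ∀ x ≤ (0 : ℝ), ∀ y ≤ (0 : ℝ), ∀ p q : ℝ, |p| ≤ R₁ →
      |q| ≤ R₁ → |x - y| ≤ 2 → |H i t x p - H i s y q| ≤ |L| * (T + 2 + 2 * R₁) := by
    intro t ht s hs x hx y hy p q hp hq hxy
    refine (hL t ht s hs x hx y hy p q hp hq).trans
      (mul_le_mul (le_abs_self L) ?_ (by positivity) (abs_nonneg _))
    have h1 : |t - s| ≤ T := abs_le.2 ⟨by linarith [ht.1, hs.2], by linarith [ht.2, hs.1]⟩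
    have h2 : |p - q| ≤ 2 * R₁ := by
      rw [abs_le] at hp hq ⊢
      constructor <;> linarith [hp.1, hp.2, hq.1, hq.2]
    linarith
  set D := |L| * (T + 2 + 2 * R₁) with hD
  suffices h : ∀ t ∈ Icc 0 T, ∀ x ≤ (0 : ℝ), H i t x 0 ≤ A + 1 + D by
    refine ⟨A + 1 + D + D, fun t ht x hx p hp => ?_⟩
    have h1 := hL' t ht t ht x hx x hx p 0
      (hp.trans ((le_max_right _ _).trans (le_max_left _ _))) (by simpa using h0.le) (by simp)
    linarith [h t ht x hx, (abs_le.1 h1).2]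
  intro t ht x hx
  by_contra! hbig
  have hlarge : ∀ s ∈ Icc 0 T, ∀ y ∈ Icc (x - 2) x, ∀ p, A + 1 ≤ H i s y p := by
    intro s hs y hy p
    rcases le_total R₁ |p| with hp | hp
    · exact hR₀ s hs y (hy.2.trans hx) p (((le_max_left _ _).trans (le_max_left _ _)).trans hp)
    · have h1 := hL' t ht s hs x hx y (hy.2.trans hx) 0 p (by simpa using h0.le) hp
        (abs_le.2 ⟨by linarith [hy.2], by linarith [hy.1]⟩)
      linarith [(abs_le.1 h1).2]
  have hψ : ContDiff ℝ 1 (fun t : ℝ => -A * t) := by fun_prop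
  have hψd : ∀ t, deriv (fun t : ℝ => -A * t) t = -A := fun t => by simp
  have hT' : T ∈ Icc 0 T := ⟨hT.le, le_rfl⟩
  have hc := abs_le.1 (hM i (x - 1) (by linarith) T hT')
  have hlat : ∀ y ≤ (0 : ℝ), (y - (x - 1)) ^ 2 = 1 → ∀ s ∈ Icc 0 T,
      u i y s - -A * s - (3 * M + 1) * (y - (x - 1)) ^ 2 <
        u i (x - 1) T - -A * T - (3 * M + 1) * (x - 1 - (x - 1)) ^ 2 := by
    intro y hy hyx s hs
    have h1 := abs_le.1 (hM i y hy s hs)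
    have h2 : A * s ≤ A * T := mul_le_mul_of_nonneg_left hs.2 (by positivity)
    rw [hyx]
    nlinarith
  obtain ⟨y, hy, s, hs, h1, h2⟩ := (hu.edgeSubsolution hψ i).exists_touch
    (θ := fun y => (3 * M + 1) * (y - (x - 1)) ^ 2) (by fun_prop) (a := x - 2) (b := x)
    (x₁ := x - 1) hx ⟨by linarith, by linarith⟩ hT' (hlat _ (by linarith) (by ring))
    (hlat _ hx (by ring))
  have hs0 : 0 < s := by
    refine lt_of_le_of_ne hs.1 fun h => ?_
    subst h
    have h3 := abs_le.1 (hM i y (hy.2.le.trans hx) 0 hs)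
    have h4 : 0 ≤ (3 * M + 1) * (y - (x - 1)) ^ 2 := by positivity
    simp only [sub_self] at h1
    linarith
  have h3 := h2 hs0
  rw [hψd] at h3
  linarith [hlarge s hs y (Ioo_subset_Icc_self hy)
    (deriv (fun y => (3 * M + 1) * (y - (x - 1)) ^ 2) y)]

/-- A bounded uniformly continuous function has a quadratic modulus of continuity up to a constant. -/
theorem exists_quadratic_modulus {h : ℝ → ℝ} {M κ : ℝ} (hκ : 0 < κ)
    (hM : ∀ x ≤ (0 : ℝ), |h x| ≤ M) (hc : UniformContinuousOn h (Iic 0)) :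
    ∃ C, ∀ x ≤ (0 : ℝ), ∀ y ≤ (0 : ℝ), |h x - h y| ≤ κ + C * (x - y) ^ 2 := by
  obtain ⟨δ, hδ, h1⟩ := Metric.uniformContinuousOn_iff.1 hc κ hκ
  have hM0 : 0 ≤ M := (abs_nonneg _).trans (hM 0 le_rfl)
  refine ⟨2 * M / δ ^ 2, fun x hx y hy => ?_⟩
  by_cases hxy : dist x y < δ
  · have := h1 x hx y hy hxy
    rw [Real.dist_eq] at this
    have h2 : 0 ≤ 2 * M / δ ^ 2 * (x - y) ^ 2 := by positivity
    linarith
  · rw [not_lt, Real.dist_eq] at hxy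
    have h2 : δ ^ 2 ≤ (x - y) ^ 2 := by
      rw [← sq_abs (x - y)]
      exact pow_le_pow_left₀ hδ.le hxy 2
    have h3 : 2 * M / δ ^ 2 * δ ^ 2 ≤ 2 * M / δ ^ 2 * (x - y) ^ 2 :=
      mul_le_mul_of_nonneg_left h2 (by positivity)
    rw [div_mul_cancel₀ _ (by positivity)] at h3
    linarith [abs_sub (h x) (h y), hM x hx, hM y hy]

/-- A bounded sub-solution lying below a uniformly continuous function at time `0` does so, up to a
small error, for a short time, uniformly on the network. -/
theorem SepSubsolution.initial_layer (hK : 0 < K) (hu : SepSubsolution T B F u)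
    (hF : ∀ i R, ∃ C, ∀ t ∈ Icc 0 T, ∀ x ≤ (0 : ℝ), ∀ p, |p| ≤ R → -C ≤ F i t x p)
    (hub : BoundedOnNetwork T u) {h : Fin K → ℝ → ℝ} (hb : ∃ M, ∀ i, ∀ x ≤ (0 : ℝ), |h i x| ≤ M)
    (h0 : ∀ i j, h i 0 = h j 0) (hc : ∀ i, UniformContinuousOn (h i) (Iic 0))
    (huh : ∀ i, ∀ x ≤ (0 : ℝ), u i x 0 ≤ h i x) {ε : ℝ} (hε : 0 < ε) :
    ∃ τ > 0, ∀ i, ∀ x ≤ (0 : ℝ), ∀ t ∈ Icc 0 T, t ≤ τ → u i x t ≤ h i x + ε := by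
  obtain ⟨M₁, hM₁⟩ := hub
  obtain ⟨M₂, hM₂⟩ := hb
  obtain ⟨M, hM, hMu, hMh⟩ : ∃ M, 0 < M ∧ (∀ i, ∀ x ≤ (0 : ℝ), ∀ t ∈ Icc 0 T, u i x t ≤ M) ∧
      ∀ i, ∀ x ≤ (0 : ℝ), -M ≤ h i x := by
    refine ⟨|M₁| + |M₂| + 1, by positivity, fun i x hx t ht => ?_, fun i x hx => ?_⟩
    · linarith [(abs_le.1 (hM₁ i x hx t ht)).2, le_abs_self M₁, abs_nonneg M₂]
    · linarith [(abs_le.1 (hM₂ i x hx)).1, le_abs_self M₂, abs_nonneg M₁]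
  set κ := ε / 4 with hκ
  have hκ0 : 0 < κ := by positivity
  have hmod := fun i => exists_quadratic_modulus (half_pos hκ0) (hM₂ i) (hc i)
  choose C' hC' using hmod
  obtain ⟨C₁, hC₁⟩ := Finite.exists_le C'
  set C := max C₁ 1 with hC
  have hC0 : 0 < C := lt_of_lt_of_le one_pos (le_max_right _ _)
  have hCC : ∀ i, C' i ≤ C := fun i => (hC₁ i).trans (le_max_left _ _)
  have hmod : ∀ i, ∀ x ≤ (0 : ℝ), ∀ y ≤ (0 : ℝ), |h i x - h i y| ≤ κ / 2 + C * (x - y) ^ 2 :=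
    fun i x hx y hy => (hC' i x hx y hy).trans
      (by linarith [mul_le_mul_of_nonneg_right (hCC i) (sq_nonneg (x - y))])
  -- Beyond distance `D` the quadratic exceeds `2M`, so the barrier is above `u`. `P` makes every
  -- slope at the junction at least `|B| + 1`, and `A` outweighs the Hamiltonian at all slopes that
  -- occur.
  set D := (2 * M + 1) / C + 1 with hD
  have hD1 : 1 ≤ D := by
    have : 0 ≤ (2 * M + 1) / C := by positivity
    linarith
  have hCD : 2 * M + 1 ≤ C * D ^ 2 := by
    have h1 : C * D = 2 * M + 1 + C := by
      rw [hD]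
      field_simp
    nlinarith
  set P := |B| + 1 + 2 * C * D with hP
  have hP0 : 0 < P := by positivity
  have hFR := fun i => hF i (2 * C * D + P)
  choose A' hA' using hFR
  obtain ⟨A₁, hA₁⟩ := Finite.exists_le A'
  set A := max A₁ 0 + 1 with hA
  have hA0 : 0 < A := by positivity
  have hAA : ∀ i, A' i < A := fun i => by
    linarith [hA₁ i, le_max_left A₁ 0]
  refine ⟨κ / A, by positivity, fun i x hx t ht htτ => ?_⟩
  -- `|y - a j|` is the network distance to the point `x` of edge `i`. The exponential adds slope
  -- `P` at the junction but at most `κ` to the height.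
  let a : Fin K → ℝ := fun j => if j = i then x else -x
  let θ : Fin K → ℝ → ℝ := fun j y => h i x + κ + C * (y - a j) ^ 2 + κ * Real.exp (P * y / κ)
  have hθ : ∀ j, ContDiff ℝ 1 (θ j) := fun j => by fun_prop
  have hθd : ∀ j y, deriv (θ j) y = 2 * C * (y - a j) + P * Real.exp (P * y / κ) := fun j y => by
    have h1 := (((hasDerivAt_id y).sub_const (a j)).pow 2).const_mul C
    have h2 := (((hasDerivAt_id y).const_mul P).div_const κ).exp.const_mul κ
    refine ((((hasDerivAt_const y (h i x + κ)).add h1).add h2).congr_deriv ?_).deriv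
    simp
    field_simp
  have ha2 : ∀ j, a j ^ 2 = x ^ 2 := fun j => by
    by_cases hj : j = i <;> simp [a, hj]
  have hθ0 : ∀ j k, θ j 0 = θ k 0 := fun j k => by
    simp only [θ, zero_sub, neg_sq, ha2]
  have hψ : ContDiff ℝ 1 (fun t : ℝ => A * t) := by fun_prop
  have hψd : ∀ t, deriv (fun t : ℝ => A * t) t = A := fun t => by simp
  have habove : ∀ j, ∀ y ≤ (0 : ℝ), h j y ≤ θ j y := by
    intro j y hy
    have hexp : 0 < κ * Real.exp (P * y / κ) := by positivity
    by_cases hj : j = i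
    · subst hj
      have := (abs_le.1 (hmod j y hy x hx)).2
      simp only [θ, a, if_true]
      linarith
    -- The path through the junction uses the modulus twice, hence `κ / 2` in it; `x² + y² ≤ (x +
    -- y)²` since `x` and `y` have the same sign.
    · have h1 := (abs_le.1 (hmod j y hy 0 le_rfl)).2
      have h2 := (abs_le.1 (hmod i 0 le_rfl x hx)).2
      rw [h0 j i] at h1
      simp only [θ, a, if_neg hj]
      nlinarith [mul_nonneg hC0.le (mul_nonneg_of_nonpos_of_nonpos hx hy)]
  have hfar : ∀ j, ∀ y ≤ (0 : ℝ), ∀ s ∈ Icc 0 T, D < |y - a j| →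
      u j y s - (θ j y + A * s) < 0 := by
    intro j y hy s hs hDy
    have h1 : D ^ 2 ≤ (y - a j) ^ 2 := by
      rw [← sq_abs (y - a j)]
      exact pow_le_pow_left₀ (by linarith) hDy.le 2
    have h2 : C * D ^ 2 ≤ C * (y - a j) ^ 2 := mul_le_mul_of_nonneg_left h1 hC0.le
    have hexp : 0 < κ * Real.exp (P * y / κ) := by positivity
    have h3 : 0 ≤ A * s := mul_nonneg hA0.le hs.1
    have := hMu j y hy s hs
    have := hMh i x hx
    simp only [θ]
    linarith
  have key : ∀ j, ∀ y ≤ (0 : ℝ), ∀ s ∈ Icc 0 T, u j y s ≤ θ j y + A * s := by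
    by_contra! hcon
    obtain ⟨j₀, y₀, hy₀, s₀, hs₀, hpos⟩ := hcon
    have hpos' : 0 < u j₀ y₀ s₀ - (θ j₀ y₀ + A * s₀) := by linarith
    have husc : ∀ j, UpperSemicontinuousOn
        (fun z : ℝ × ℝ => u j z.1 z.2 - (θ j z.1 + A * z.2)) (edgeCyl T) := fun j => by
      have hcont : ContinuousOn (fun z : ℝ × ℝ => -(θ j z.1 + A * z.2)) (edgeCyl T) := by
        have := (hθ j).continuous
        fun_prop
      simpa only [sub_eq_add_neg] using (hu.usc j).add hcont.upperSemicontinuousOn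
    obtain ⟨j, ⟨y, s⟩, ⟨hy, hs⟩, hmax⟩ := exists_family_max
      (C := Icc (x - D) 0 ×ˢ Icc 0 T) (S := edgeCyl T) (isCompact_Icc.prod isCompact_Icc)
      (prod_mono (fun y hy => hy.2) subset_rfl) husc (i₀ := j₀) (x₀ := (y₀, s₀)) ⟨hy₀, hs₀⟩
      (fun j z hz hzC => by
        refine (hfar j z.1 hz.1 z.2 hz.2 ?_).trans hpos'
        have hz1 : z.1 < x - D := by
          by_contra! hge
          exact hzC ⟨⟨hge, hz.1⟩, hz.2⟩
        rw [lt_abs]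
        right
        by_cases hj : j = i
        · simp only [a, if_pos hj]
          linarith
        · simp only [a, if_neg hj]
          linarith)
    have hval : 0 < u j y s - (θ j y + A * s) := hpos'.trans_le (hmax j₀ (y₀, s₀) ⟨hy₀, hs₀⟩)
    have hnear : |y - a j| ≤ D := by
      by_contra! hgt
      exact hval.not_gt (hfar j y hy.2 s hs hgt)
    have hs0 : s ∈ Ioc 0 T := by
      refine ⟨lt_of_le_of_ne hs.1 fun hs0 => ?_, hs.2⟩
      subst hs0
      have := huh j y hy.2
      have := habove j y hy.2
      simp only [mul_zero, add_zero] at hval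
      linarith
    have hderiv : ∀ k, |y - a k| ≤ D → |deriv (θ k) y| ≤ 2 * C * D + P := by
      intro k hk
      have hexp : Real.exp (P * y / κ) ≤ 1 := Real.exp_le_one_iff.2
        (div_nonpos_of_nonpos_of_nonneg (mul_nonpos_of_nonneg_of_nonpos hP0.le hy.2) hκ0.le)
      rw [hθd]
      refine (abs_add_le _ _).trans (add_le_add ?_ ?_)
      · rw [abs_mul, abs_of_pos (by positivity)]
        exact mul_le_mul_of_nonneg_left hk (by positivity)
      · rw [abs_of_pos (by positivity)]
        nlinarith
    have hbig : ∀ k, |y - a k| ≤ D → 0 < A + F k s y (deriv (θ k) y) := fun k hk => by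
      linarith [hA' k s hs y hy.2 _ (hderiv k hk), hAA k]
    rcases hy.2.lt_or_eq with hy0 | hy0
    · have := hu.edge (θ j) (fun t => A * t) (hθ j) hψ j y hy0 s hs0 (by
        filter_upwards [self_mem_nhdsWithin] with z hz using hmax j z hz)
      rw [hψd] at this
      exact this.not_gt (hbig j hnear)
    · dsimp only at hy0
      subst hy0
      have hak : ∀ k, |0 - a k| = |0 - a j| := fun k => by
        rw [← sq_eq_sq_iff_abs_eq_abs, zero_sub, zero_sub, neg_sq, neg_sq, ha2, ha2]
      have hnear' : ∀ k, |0 - a k| ≤ D := fun k => (hak k).trans_le hnear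
      have := hu.junction θ (fun t => A * t) hθ hψ hθ0 s hs0 (fun k => by
        filter_upwards [self_mem_nhdsWithin] with z hz
        have := hmax k z hz
        simp only [hu.glued j k s hs, hθ0 j k] at this
        exact this)
      rw [hψd] at this
      rcases this with hsum | ⟨k, hk⟩
      · have h1 : ∀ k ∈ Finset.univ, |B| + 1 ≤ deriv (θ k) 0 := fun k _ => by
          rw [hθd]
          simp only [mul_zero, zero_div, Real.exp_zero, mul_one]
          have := mul_le_mul_of_nonneg_left (abs_le.1 (hnear' k)).1 (by positivity : 0 ≤ 2 * C)
          linarith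
        have h2 := Finset.card_nsmul_le_sum Finset.univ _ _ h1
        rw [Finset.card_univ, Fintype.card_fin, nsmul_eq_mul] at h2
        have h3 : (1 : ℝ) ≤ K := by exact_mod_cast hK
        nlinarith [le_abs_self B, abs_nonneg B]
      · exact hk.not_gt (hbig k (hnear' k))
  have h1 := key i x hx t ht
  have h2 : Real.exp (P * x / κ) ≤ 1 := Real.exp_le_one_iff.2
    (div_nonpos_of_nonpos_of_nonneg (mul_nonpos_of_nonneg_of_nonpos hP0.le hx) hκ0.le)
  have h3 : A * t ≤ κ := by
    rw [le_div_iff₀ hA0] at htτ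
    linarith
  simp only [θ, a, if_true, sub_self] at h1
  nlinarith

end Barrier

/-! ### Penalisation at infinity and the doubling argument -/

section Final

open Set Filter Topology

variable {K : ℕ} {T B : ℝ} {H : Fin K → ℝ → ℝ → ℝ → ℝ} {u v : Fin K → ℝ → ℝ → ℝ}

theorem HamiltonianLipschitz.continuousHamiltonian (hLip : HamiltonianLipschitz T H) (i : Fin K) :
    ContinuousHamiltonian T (H i) := by
  rintro ⟨t, x, p⟩ ⟨ht, hx, -⟩
  obtain ⟨L, hL⟩ := hLip i (|p| + 1) (by positivity)
  rw [ContinuousWithinAt, tendsto_iff_dist_tendsto_zero]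
  have hnear : ∀ᶠ z : ℝ × ℝ × ℝ in 𝓝[Icc 0 T ×ˢ Iic 0 ×ˢ univ] (t, x, p), |z.2.2| < |p| + 1 := by
    have hcont : Continuous fun z : ℝ × ℝ × ℝ => |z.2.2| := by fun_prop
    exact mem_nhdsWithin_of_mem_nhds
      (hcont.continuousAt.eventually (gt_mem_nhds (by dsimp only; linarith)))
  refine squeeze_zero' (Eventually.of_forall fun _ => dist_nonneg)
    (g := fun z : ℝ × ℝ × ℝ => L * (|z.1 - t| + |z.2.1 - x| + |z.2.2 - p|)) ?_ ?_
  · filter_upwards [hnear, self_mem_nhdsWithin] with z hz hz'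
    exact hL z.1 hz'.1 t ht z.2.1 hz'.2.1 x hx z.2.2 p hz.le (by linarith)
  · have hcont : Continuous fun z : ℝ × ℝ × ℝ => L * (|z.1 - t| + |z.2.1 - x| + |z.2.2 - p|) := by
      fun_prop
    exact (hcont.tendsto' (t, x, p) 0 (by simp)).mono_left nhdsWithin_le_nhds

/-- A smooth function growing linearly at infinity. -/
theorem exists_linear_growth : ∃ g : ℝ → ℝ, ContDiff ℝ 1 g ∧ deriv g 0 = 0 ∧
    (∀ x, |deriv g x| ≤ 1) ∧ (∀ x, 0 ≤ g x) ∧ ∀ x, |x| - 1 ≤ g x := by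
  have hpos : ∀ x : ℝ, 0 < 1 + x ^ 2 := fun x => by positivity
  have hd : ∀ x : ℝ, HasDerivAt (fun x : ℝ => √(1 + x ^ 2) - 1) (x / √(1 + x ^ 2)) x := fun x => by
    have h1 : HasDerivAt (fun x : ℝ => 1 + x ^ 2) (2 * x) x :=
      (((hasDerivAt_id x).pow 2).const_add 1).congr_deriv (by simp)
    refine ((h1.sqrt (hpos x).ne').sub_const 1).congr_deriv ?_
    field_simp
  have hle : ∀ x : ℝ, |x| ≤ √(1 + x ^ 2) := fun x => Real.abs_le_sqrt (by linarith)
  refine ⟨fun x => √(1 + x ^ 2) - 1, ?_, ?_, fun x => ?_, fun x => ?_, fun x => ?_⟩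
  · exact (ContDiff.sqrt (by fun_prop) fun x => (hpos x).ne').sub contDiff_const
  · rw [(hd 0).deriv, zero_div]
  · rw [(hd x).deriv, abs_div, abs_of_pos (Real.sqrt_pos.2 (hpos x))]
    exact div_le_one_of_le₀ (hle x) (Real.sqrt_nonneg _)
  · have : (1 : ℝ) ≤ √(1 + x ^ 2) := Real.one_le_sqrt.2 (by nlinarith [sq_nonneg x])
    linarith
  · linarith [hle x]

theorem abs_div_le_of_sq_le {a ε C : ℝ} (hε : 0 < ε) (hC : 0 ≤ C)
    (h : a ^ 2 / (2 * ε) ≤ C * |a|) : |a / ε| ≤ 2 * C := by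
  rw [abs_div, abs_of_pos hε, div_le_iff₀ hε]
  rw [div_le_iff₀ (by positivity), ← sq_abs] at h
  rcases (abs_nonneg a).eq_or_lt with h0 | h0
  · rw [← h0]
    positivity
  · nlinarith

theorem exists_uniform_coercivity (hCoer : HamiltonianCoercive T H) (M : ℝ) :
    ∃ R, ∀ i, ∀ t ∈ Icc 0 T, ∀ x ≤ (0 : ℝ), ∀ p, R ≤ |p| → M ≤ H i t x p := by
  have := fun i => hCoer i M
  choose R hR using this
  obtain ⟨R', hR'⟩ := Finite.exists_le R
  exact ⟨R', fun i t ht x hx p hp => hR i t ht x hx p ((hR' i).trans hp)⟩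

theorem exists_uniform_lipschitz (hLip : HamiltonianLipschitz T H) (R : ℝ) :
    ∃ L, 0 ≤ L ∧ ∀ i, ∀ t ∈ Icc 0 T, ∀ s ∈ Icc 0 T, ∀ x ≤ (0 : ℝ), ∀ p q : ℝ, |p| ≤ R → |q| ≤ R →
      |H i t x p - H i s x q| ≤ L * (|t - s| + |p - q|) := by
  have := fun i => hLip i (max R 1) (by positivity)
  choose L hL using this
  obtain ⟨L', hL'⟩ := Finite.exists_le L
  refine ⟨max L' 0, le_max_right _ _, fun i t ht s hs x hx p q hp hq => ?_⟩
  have h := hL i t ht s hs x hx x hx p q (hp.trans (le_max_left _ _)) (hq.trans (le_max_left _ _))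
  rw [sub_self, abs_zero, add_zero] at h
  exact h.trans (mul_le_mul_of_nonneg_right ((hL' i).trans (le_max_left _ _)) (by positivity))

/-- Near the initial time, `u(x, t) - v(x, s)` is not much larger than `m`, the bound at time `0`. -/
theorem difference_initial_layer (hK : 0 < K) (hT : 0 < T) (hLip : HamiltonianLipschitz T H)
    (hCoer : HamiltonianCoercive T H) (hu : IsSubsolution T B H u) (hv : IsSupersolution T B H v)
    (hub : BoundedOnNetwork T u) (hvb : BoundedOnNetwork T v)
    (hinit : InitiallyUniformlyContinuous u ∨ InitiallyUniformlyContinuous v) {m : ℝ}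
    (hm : ∀ i, ∀ x ≤ (0 : ℝ), u i x 0 - v i x 0 ≤ m) {ε : ℝ} (hε : 0 < ε) :
    ∃ τ > 0, ∀ i, ∀ x ≤ (0 : ℝ), ∀ t ∈ Icc 0 T, ∀ s ∈ Icc 0 T, t ≤ τ → s ≤ τ →
      u i x t - v i x s ≤ m + ε := by
  have h0T : (0 : ℝ) ∈ Icc 0 T := ⟨le_rfl, hT.le⟩
  -- One uniformly continuous `h` with `u ≤ h ≤ v + m` at time `0` suffices: `u` itself or `v + m`.
  suffices hh : ∃ h : Fin K → ℝ → ℝ, (∃ M, ∀ i, ∀ x ≤ (0 : ℝ), |h i x| ≤ M) ∧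
      (∀ i j, h i 0 = h j 0) ∧ (∀ i, UniformContinuousOn (h i) (Iic 0)) ∧
      (∀ i, ∀ x ≤ (0 : ℝ), u i x 0 ≤ h i x) ∧ ∀ i, ∀ x ≤ (0 : ℝ), -v i x 0 ≤ m - h i x by
    obtain ⟨h, ⟨M, hM⟩, hglue, hc, huh, hvh⟩ := hh
    have hvb' : BoundedOnNetwork T (fun i x t => -v i x t) := by
      obtain ⟨M, hM⟩ := hvb
      exact ⟨M, fun i x hx t ht => by simpa using hM i x hx t ht⟩
    obtain ⟨τ₁, hτ₁, h1⟩ := hu.sepSubsolution.initial_layer hK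
      (hamiltonian_bddBelow hLip hCoer) hub ⟨M, hM⟩ hglue hc huh (half_pos hε)
    obtain ⟨τ₂, hτ₂, h2⟩ := hv.neg_sepSubsolution.initial_layer hK
      -- The barrier for `-v` needs `H` bounded above, which the Lipschitz condition does not give
      -- on an unbounded edge; the bounded sub-solution `u` does.
      (fun i R => by
        obtain ⟨C, hC⟩ := hamiltonian_bddAbove hT hLip hCoer hu.sepSubsolution hub i R
        exact ⟨C, fun t ht x hx p hp => neg_le_neg (hC t ht x hx (-p) (by rwa [abs_neg]))⟩)
      hvb' (h := fun i x => m - h i x)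
      ⟨|m| + M, fun i x hx => (abs_sub _ _).trans (by linarith [hM i x hx])⟩
      (fun i j => by simp only [hglue i j])
      (fun i => (uniformContinuous_const.sub uniformContinuous_id).comp_uniformContinuousOn (hc i))
      hvh (half_pos hε)
    refine ⟨min τ₁ τ₂, lt_min hτ₁ hτ₂, fun i x hx t ht s hs htτ hsτ => ?_⟩
    have := h1 i x hx t ht (htτ.trans (min_le_left _ _))
    have := h2 i x hx s hs (hsτ.trans (min_le_right _ _))
    linarith
  obtain hi | hi := hinit
  · obtain ⟨M, hM⟩ := hub
    exact ⟨fun i x => u i x 0, ⟨M, fun i x hx => hM i x hx 0 h0T⟩, fun i j => hu.glued i j 0 h0T,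
      hi, fun i x hx => le_rfl, fun i x hx => by linarith [hm i x hx]⟩
  · obtain ⟨M, hM⟩ := hvb
    exact ⟨fun i x => v i x 0 + m,
      ⟨M + |m|, fun i x hx => (abs_add_le _ _).trans (by linarith [hM i x hx 0 h0T])⟩,
      fun i j => by simp only [hv.glued i j 0 h0T],
      fun i => (uniformContinuous_id.add uniformContinuous_const).comp_uniformContinuousOn (hi i),
      fun i x hx => by linarith [hm i x hx], fun i x hx => by linarith⟩

/-- The doubling argument, once the penalisation parameter `ε` is such that the Hamiltonians hardly
differ between the two times of a maximum point. -/
theorem doubling_contradiction (hK : 0 < K) (hLip : HamiltonianLipschitz T H)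
    (hCoer : HamiltonianCoercive T H) (hu : IsSubsolution T B H u) (hv : IsSupersolution T B H v)
    {M m δ τ₀ η ε l R : ℝ}
    (hub : ∀ i, ∀ x ≤ (0 : ℝ), ∀ t ∈ Icc 0 T, |u i x t| ≤ M)
    (hvb : ∀ i, ∀ x ≤ (0 : ℝ), ∀ t ∈ Icc 0 T, |v i x t| ≤ M)
    (hm : -(2 * M) ≤ m) (hδ : 0 < δ)
    {i₁ : Fin K} {x₁ t₁ : ℝ} (hx₁ : x₁ ≤ 0) (ht₁ : t₁ ∈ Icc 0 T)
    (hbig : m + δ ≤ u i₁ x₁ t₁ - v i₁ x₁ t₁) (hτ₀ : 0 < τ₀)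
    (hlayer : ∀ i, ∀ x ≤ (0 : ℝ), ∀ t ∈ Icc 0 T, ∀ s ∈ Icc 0 T, t ≤ τ₀ → s ≤ τ₀ →
      u i x t - v i x s ≤ m + δ / 4)
    (hη : 0 < η) (hηT : η * T ≤ δ / 4) (hε : 0 < ε) (hετ : 8 * M * ε ≤ τ₀ ^ 2)
    (hl : ∀ i, ∀ x ≤ (0 : ℝ), ∀ t ∈ Icc 0 T, ∀ s ∈ Icc 0 T,
      (∀ t' ∈ Icc 0 T, ∀ s' ∈ Icc 0 T, u i x t' - η * t' - v i x s' - (t' - s') ^ 2 / (2 * ε) ≤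
        u i x t - η * t - v i x s - (t - s) ^ 2 / (2 * ε)) → |(t - s) / ε| ≤ l)
    (hR : ∀ i, ∀ t ∈ Icc 0 T, ∀ x ≤ (0 : ℝ), ∀ p, R ≤ |p| → l + 1 ≤ H i t x p)
    (hH : ∀ i, ∀ t ∈ Icc 0 T, ∀ s ∈ Icc 0 T, ∀ x ≤ (0 : ℝ), ∀ q, |(t - s) / ε| ≤ l → |q| ≤ R →
      |H i t x q - H i s x q| ≤ η / 2) : False := by
  obtain ⟨g, hg, hg0, hg1, hgpos, hglin⟩ := exists_linear_growth
  obtain ⟨L, hL0, hL⟩ := exists_uniform_lipschitz hLip (R + 1)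
  -- The penalty `β g` may change the Hamiltonian by at most `η / 4` and cost at most `δ / 4` at the
  -- given point.
  obtain ⟨β, hβ, hβ1, hβL, hβg⟩ : ∃ β > 0, β ≤ 1 ∧ L * β ≤ η / 4 ∧ β * g x₁ ≤ δ / 4 := by
    have hL1 : 0 < L + 1 := by positivity
    have hg1 : 0 < g x₁ + 1 := by linarith [hgpos x₁]
    refine ⟨min 1 (min (η / 4 / (L + 1)) (δ / 4 / (g x₁ + 1))), by positivity, min_le_left _ _,
      ?_, ?_⟩
    · have := (min_le_right (1 : ℝ) _).trans (min_le_left (η / 4 / (L + 1)) (δ / 4 / (g x₁ + 1)))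
      have h2 := (le_div_iff₀ hL1).1 this
      have h3 : 0 < min 1 (min (η / 4 / (L + 1)) (δ / 4 / (g x₁ + 1))) := by positivity
      linarith
    · have := (min_le_right (1 : ℝ) _).trans (min_le_right (η / 4 / (L + 1)) (δ / 4 / (g x₁ + 1)))
      have h2 := (le_div_iff₀ hg1).1 this
      have h3 : 0 < min 1 (min (η / 4 / (L + 1)) (δ / 4 / (g x₁ + 1))) := by positivity
      linarith
  have hβg' : ContDiff ℝ 1 (fun x => β * g x) := contDiff_const.mul hg
  have hdβ : ∀ x, deriv (fun x => β * g x) x = β * deriv g x := fun x =>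
    deriv_const_mul _ (hg.differentiable one_ne_zero x)
  have hdβ1 : ∀ x, |β * deriv g x| ≤ β := fun x => by
    rw [abs_mul, abs_of_pos hβ]
    nlinarith [hg1 x]
  have hu' := hu.sepSubsolution.sub_separable hβg' (by rw [hdβ, hg0, mul_zero]) η
  have hw := hv.neg_sepSubsolution
  have hd' : Continuous (deriv fun x => β * g x) := hβg'.continuous_deriv le_rfl
  have hF : ∀ i, ContinuousHamiltonian T
      (fun t x p => H i t x (p + deriv (fun x => β * g x) x) + η) := fun i => by
    have h1 : ContinuousOn (fun z : ℝ × ℝ × ℝ =>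
        (z.1, z.2.1, z.2.2 + deriv (fun x => β * g x) z.2.1)) (Icc 0 T ×ˢ Iic 0 ×ˢ univ) := by
      fun_prop
    exact ((hLip.continuousHamiltonian i).comp h1 fun z hz => ⟨hz.1, hz.2.1, mem_univ _⟩).add
      continuousOn_const
  have hG : ∀ i, ContinuousHamiltonian T (fun t x p => -H i t x (-p)) := fun i => by
    have h1 : ContinuousOn (fun z : ℝ × ℝ × ℝ => (z.1, z.2.1, -z.2.2))
        (Icc 0 T ×ˢ Iic 0 ×ˢ univ) := by fun_prop
    exact ((hLip.continuousHamiltonian i).comp h1 fun z hz => ⟨hz.1, hz.2.1, mem_univ _⟩).neg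
  have hcoer : HamiltonianCoercive T
      (fun i t x p => H i t x (p + deriv (fun x => β * g x) x) + η) := fun i N => by
    obtain ⟨R', hR'⟩ := hCoer i N
    refine ⟨R' + 1, fun t ht x hx p hp => ?_⟩
    have h1 := hR' t ht x hx (p + deriv (fun x => β * g x) x) (by
      rw [hdβ]
      have h2 := abs_sub_abs_le_abs_sub p (-(β * deriv g x))
      rw [abs_neg, sub_neg_eq_add] at h2
      linarith [hdβ1 x])
    linarith
  set S : Set (ℝ × ℝ × ℝ) := Iic 0 ×ˢ Icc 0 T ×ˢ Icc 0 T with hS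
  have husc : ∀ i, UpperSemicontinuousOn (fun z : ℝ × ℝ × ℝ =>
      (u i z.1 z.2.1 - (β * g z.1 + η * z.2.1)) + -v i z.1 z.2.2 +
        -((z.2.1 - z.2.2) ^ 2 / (2 * ε))) S := by
    intro i
    have h1 := (hu'.usc i).comp (g := fun z : ℝ × ℝ × ℝ => (z.1, z.2.1)) (t := S) (by fun_prop)
      fun z hz => ⟨hz.1, hz.2.1⟩
    have h2 := (hw.usc i).comp (g := fun z : ℝ × ℝ × ℝ => (z.1, z.2.2)) (t := S) (by fun_prop)
      fun z hz => ⟨hz.1, hz.2.2⟩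
    have h3 : ContinuousOn (fun z : ℝ × ℝ × ℝ => -((z.2.1 - z.2.2) ^ 2 / (2 * ε))) S := by
      fun_prop
    exact (h1.add h2).add h3.upperSemicontinuousOn
  have hpos₁ : m + δ / 2 ≤ (u i₁ x₁ t₁ - (β * g x₁ + η * t₁)) + -v i₁ x₁ t₁ +
      -((t₁ - t₁) ^ 2 / (2 * ε)) := by
    have : η * t₁ ≤ η * T := mul_le_mul_of_nonneg_left ht₁.2 hη.le
    rw [sub_self, zero_pow two_ne_zero, zero_div]
    linarith
  obtain ⟨i₀, ⟨x₀, τ, σ⟩, ⟨hx₀, hτ, hσ⟩, hmax⟩ := exists_family_max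
    (C := Icc (-(4 * M / β + 1)) 0 ×ˢ Icc 0 T ×ˢ Icc 0 T) (S := S)
    (isCompact_Icc.prod (isCompact_Icc.prod isCompact_Icc))
    (prod_mono (fun y hy => hy.2) subset_rfl) husc (i₀ := i₁) (x₀ := (x₁, t₁, t₁))
    ⟨hx₁, ht₁, ht₁⟩ (fun i z hz hzC => by
      refine lt_of_lt_of_le ?_ hpos₁
      have hz1 : z.1 < -(4 * M / β + 1) := by
        by_contra! hge
        exact hzC ⟨⟨hge, hz.1⟩, hz.2⟩
      have h1 : 4 * M / β ≤ g z.1 := by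
        have := hglin z.1
        rw [abs_of_nonpos hz.1] at this
        linarith
      rw [div_le_iff₀ hβ] at h1
      have h2 := (abs_le.1 (hub i z.1 hz.1 z.2.1 hz.2.1)).2
      have h3 := (abs_le.1 (hvb i z.1 hz.1 z.2.2 hz.2.2)).1
      have h4 : 0 ≤ η * z.2.1 := mul_nonneg hη.le hz.2.1.1
      have h5 : 0 ≤ (z.2.1 - z.2.2) ^ 2 / (2 * ε) := by positivity
      linarith)
  replace hx₀ := hx₀.2
  dsimp only at hx₀ hτ hσ
  have hval := hpos₁.trans (hmax i₁ (x₁, t₁, t₁) ⟨hx₁, ht₁, ht₁⟩)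
  dsimp only at hval
  have hgx : 0 ≤ β * g x₀ := mul_nonneg hβ.le (hgpos x₀)
  have hητ : 0 ≤ η * τ := mul_nonneg hη.le hτ.1
  have hsq : 0 ≤ (τ - σ) ^ 2 / (2 * ε) := by positivity
  have hclose : |τ - σ| ≤ τ₀ := by
    have h2 := (abs_le.1 (hub i₀ x₀ hx₀ τ hτ)).2
    have h3 := (abs_le.1 (hvb i₀ x₀ hx₀ σ hσ)).1
    have h4 : (τ - σ) ^ 2 / (2 * ε) ≤ 4 * M := by linarith
    rw [div_le_iff₀ (by positivity)] at h4
    exact abs_le_of_sq_le_sq (by linarith) hτ₀.le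
  -- The times are within `τ₀` of each other and not both in the initial layer, so neither vanishes.
  have hnl : ¬ (τ ≤ τ₀ ∧ σ ≤ τ₀) := fun ⟨h1, h2⟩ => by
    linarith [hlayer i₀ x₀ hx₀ τ hτ σ hσ h1 h2]
  have hτ0 : 0 < τ := by
    refine lt_of_le_of_ne hτ.1 fun h => hnl ⟨by linarith, ?_⟩
    linarith [(abs_le.1 hclose).1]
  have hσ0 : 0 < σ := by
    refine lt_of_le_of_ne hσ.1 fun h => hnl ⟨?_, by linarith⟩
    linarith [(abs_le.1 hclose).2]
  have hlam : |(τ - σ) / ε| ≤ l := hl i₀ x₀ hx₀ τ hτ σ hσ fun t' ht' s' hs' => by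
    have := hmax i₀ (x₀, t', s') ⟨hx₀, ht', hs'⟩
    dsimp only at this
    linarith
  refine hu'.not_doubled_max hK hw hF hG hcoer hε hx₀ ⟨hτ0, hτ.2⟩ ⟨hσ0, hσ.2⟩ (i₀ := i₀)
    (fun i x hx t ht s hs => ?_) fun i p hp => ?_
  · simpa only [sub_eq_add_neg] using hmax i (x, t, s) ⟨hx, ht, hs⟩
  · rw [hdβ] at hp
    -- Of the strictness `η`, the time shift uses `η / 2` and the penalty `η / 4`; the rest is
    -- positive.
    set q := p + β * deriv g x₀ with hq
    have hqR : |q| ≤ R := by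
      by_contra! h
      have := hR i τ hτ x₀ hx₀ q h.le
      linarith [(abs_le.1 hlam).1]
    have hpq : |p - q| ≤ β := by
      rw [hq, sub_add_cancel_left, abs_neg]
      exact hdβ1 x₀
    have hpR : |p| ≤ R + 1 := by
      have := abs_sub_abs_le_abs_sub p q
      linarith
    have h1 := hL i σ hσ σ hσ x₀ hx₀ p q hpR (by linarith)
    rw [sub_self, abs_zero, zero_add] at h1
    have h2 : L * |p - q| ≤ L * β := mul_le_mul_of_nonneg_left hpq hL0
    have h3 := hH i τ hτ σ hσ x₀ hx₀ q hlam hqR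
    rw [neg_neg]
    linarith [(abs_le.1 h1).2, (abs_le.1 h3).1]

end Final

theorem mainTheorem6 (K : ℕ) (hK : 0 < K) (T : ℝ) (hT : 0 < T) (B : ℝ)
    (H : Fin K → ℝ → ℝ → ℝ → ℝ)
    (hLip : HamiltonianLipschitz T H) (hCoer : HamiltonianCoercive T H)
    (u v : Fin K → ℝ → ℝ → ℝ)
    (hu : IsSubsolution T B H u) (hv : IsSupersolution T B H v)
    (hub : BoundedOnNetwork T u) (hvb : BoundedOnNetwork T v)
    (hinit : InitiallyUniformlyContinuous u ∨ InitiallyUniformlyContinuous v)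
    (hreg : TimeIndependent T H ∨ LipschitzOnNetwork T u ∨ LipschitzOnNetwork T v) :
    ∀ t ∈ Set.Icc 0 T, supDiff u v t ≤ supDiff u v 0 := by
  intro t₁ ht₁
  have h0T : (0 : ℝ) ∈ Set.Icc 0 T := ⟨le_rfl, hT.le⟩
  have hne : Nonempty (Fin K × Set.Iic (0 : ℝ)) := ⟨(⟨0, hK⟩, ⟨0, Set.mem_Iic.2 le_rfl⟩)⟩
  obtain ⟨M, hM, hMu, hMv⟩ : ∃ M > 0, (∀ i, ∀ x ≤ (0 : ℝ), ∀ t ∈ Set.Icc 0 T, |u i x t| ≤ M) ∧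
      ∀ i, ∀ x ≤ (0 : ℝ), ∀ t ∈ Set.Icc 0 T, |v i x t| ≤ M := by
    obtain ⟨M₁, h1⟩ := hub
    obtain ⟨M₂, h2⟩ := hvb
    refine ⟨|M₁| + |M₂| + 1, by positivity, fun i x hx t ht => ?_, fun i x hx t ht => ?_⟩
    · linarith [h1 i x hx t ht, le_abs_self M₁, abs_nonneg M₂]
    · linarith [h2 i x hx t ht, le_abs_self M₂, abs_nonneg M₁]
  have hm : ∀ i, ∀ x ≤ (0 : ℝ), u i x 0 - v i x 0 ≤ supDiff u v 0 := fun i x hx => by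
    refine le_ciSup (f := fun z : Fin K × Set.Iic (0 : ℝ) => u z.1 z.2 0 - v z.1 z.2 0)
      ⟨2 * M, ?_⟩ (i, ⟨x, hx⟩)
    rintro _ ⟨⟨j, y⟩, rfl⟩
    linarith [(abs_le.1 (hMu j y y.2 0 h0T)).2, (abs_le.1 (hMv j y y.2 0 h0T)).1]
  have hm2 : -(2 * M) ≤ supDiff u v 0 := by
    have h := hm ⟨0, hK⟩ 0 le_rfl
    linarith [(abs_le.1 (hMu ⟨0, hK⟩ 0 le_rfl 0 h0T)).1, (abs_le.1 (hMv ⟨0, hK⟩ 0 le_rfl 0 h0T)).2]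
  refine ciSup_le fun ⟨i₁, x₁, hx₁⟩ => ?_
  by_contra! hcon
  dsimp only at hcon
  obtain ⟨δ, hδ, hbig⟩ : ∃ δ > 0, supDiff u v 0 + δ ≤ u i₁ x₁ t₁ - v i₁ x₁ t₁ :=
    ⟨u i₁ x₁ t₁ - v i₁ x₁ t₁ - supDiff u v 0, by linarith, by linarith⟩
  obtain ⟨τ₀, hτ₀, hlayer⟩ := difference_initial_layer hK hT hLip hCoer hu hv hub hvb hinit hm
    (by positivity : 0 < δ / 4)
  have hη : 0 < δ / 4 / T := by positivity
  have hηT : δ / 4 / T * T ≤ δ / 4 := (div_mul_cancel₀ _ hT.ne').le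
  set η := δ / 4 / T with hηdef
  clear_value η
  have hε₁ : 0 < τ₀ ^ 2 / (8 * M) := by positivity
  have hε₁M : 8 * M * (τ₀ ^ 2 / (8 * M)) = τ₀ ^ 2 := by field_simp
  rcases hreg with hTI | hreg
  -- Without time dependence the crude bound `|t - s| / ε ≤ T / ε` is enough, and `ε` need not be
  -- small compared with `η`.
  · obtain ⟨R, hR⟩ := exists_uniform_coercivity hCoer (T / (τ₀ ^ 2 / (8 * M)) + 1)
    refine doubling_contradiction hK hLip hCoer hu hv hMu hMv hm2 hδ hx₁ ht₁ hbig hτ₀ hlayer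
      hη hηT hε₁ hε₁M.le (fun i x hx t ht s hs _ => ?_) hR
      fun i t ht s hs x hx q _ _ => ?_
    · rw [abs_div, abs_of_pos hε₁]
      refine div_le_div_of_nonneg_right (abs_le.2 ⟨?_, ?_⟩) hε₁.le
      · linarith [ht.1, hs.2]
      · linarith [ht.2, hs.1]
    · rw [hTI i t ht s hs x hx q, sub_self, abs_zero]
      positivity
  · obtain ⟨N, hN, hreg⟩ : ∃ N ≥ 0,
        (∀ i, ∀ x ≤ (0 : ℝ), ∀ t ∈ Set.Icc 0 T, ∀ s ∈ Set.Icc 0 T,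
          |u i x t - u i x s| ≤ N * |t - s|) ∨
        ∀ i, ∀ x ≤ (0 : ℝ), ∀ t ∈ Set.Icc 0 T, ∀ s ∈ Set.Icc 0 T,
          |v i x t - v i x s| ≤ N * |t - s| := by
      rcases hreg with ⟨N, hN⟩ | ⟨N, hN⟩
      · refine ⟨|N|, abs_nonneg N, Or.inl fun i x hx t ht s hs => ?_⟩
        have h := hN i x hx x hx t ht s hs
        rw [sub_self, abs_zero, zero_add] at h
        exact h.trans (mul_le_mul_of_nonneg_right (le_abs_self N) (abs_nonneg _))
      · refine ⟨|N|, abs_nonneg N, Or.inr fun i x hx t ht s hs => ?_⟩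
        have h := hN i x hx x hx t ht s hs
        rw [sub_self, abs_zero, zero_add] at h
        exact h.trans (mul_le_mul_of_nonneg_right (le_abs_self N) (abs_nonneg _))
    obtain ⟨R, hR⟩ := exists_uniform_coercivity hCoer (2 * (N + η) + 1)
    obtain ⟨L, hL0, hL⟩ := exists_uniform_lipschitz hLip R
    have hl0 : 0 ≤ 2 * (N + η) := by positivity
    set l := 2 * (N + η) with hldef
    have hLl : 0 < 2 * (L * l + 1) := by positivity
    -- Here `l` is independent of `ε`, so `L |t - s| ≤ L l ε ≤ η / 2` can be arranged.
    have hε : 0 < min (τ₀ ^ 2 / (8 * M)) (η / (2 * (L * l + 1))) :=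
      lt_min hε₁ (div_pos hη hLl)
    have hετ := mul_le_mul_of_nonneg_left
      (min_le_left (τ₀ ^ 2 / (8 * M)) (η / (2 * (L * l + 1)))) (by positivity : 0 ≤ 8 * M)
    have hεη := (le_div_iff₀ hLl).1
      (min_le_right (τ₀ ^ 2 / (8 * M)) (η / (2 * (L * l + 1))))
    set ε := min (τ₀ ^ 2 / (8 * M)) (η / (2 * (L * l + 1))) with hεdef
    clear_value ε
    rw [hε₁M] at hετ
    refine doubling_contradiction hK hLip hCoer hu hv hMu hMv hm2 hδ hx₁ ht₁ hbig hτ₀ hlayer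
      hη hηT hε hετ (fun i x hx t ht s hs hmax => ?_) hR
      fun i t ht s hs x hx q hts hq => ?_
    · refine abs_div_le_of_sq_le hε (by positivity) ?_
      have hηts : η * (s - t) ≤ η * |t - s| := by
        rw [abs_sub_comm]
        exact mul_le_mul_of_nonneg_left (le_abs_self _) hη.le
      -- Moving only the time of the Lipschitz function onto the other one gives `(t - s)² / 2ε ≤ (N
      -- + η) |t - s|`.
      rcases hreg with hreg | hreg
      · have h1 := hmax s hs s hs
        rw [sub_self s, zero_pow two_ne_zero, zero_div] at h1
        linarith [(abs_le.1 (hreg i x hx t ht s hs)).2]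
      · have h1 := hmax t ht t ht
        rw [sub_self t, zero_pow two_ne_zero, zero_div] at h1
        have : 0 ≤ η * |t - s| := by positivity
        linarith [(abs_le.1 (hreg i x hx t ht s hs)).2]
    · have h1 := hL i t ht s hs x hx q q hq hq
      rw [sub_self q, abs_zero, add_zero] at h1
      rw [abs_div, abs_of_pos hε, div_le_iff₀ hε] at hts
      have h2 : L * |t - s| ≤ L * (l * ε) := mul_le_mul_of_nonneg_left hts hL0
      nlinarith
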